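/- **Problem.** An instance consists of $n$ jobs, $c$ cores and an amount $K\in\mathbb{N}$ of cache; job $j$ has a load $a_j\in\mathbb{Q}_{\ge 0}$ and a minimal cache demand $x_j\in\mathbb{N}$. A solution is a pair $(p,S)$ of a cache partition $p:\{1,\dots,c\}\to\mathbb{N}$ with $\sum_{i=1}^{c}p(i)=K$ and a job assignment $S:\{1,\dots,n\}\to\{1,\dots,c\}$ such that every job runs on a core with enough cache, $p(S(j))\ge x_j$ for all $j$. Its makespan is $\max_i\sum_{j:\,S(j)=i}a_j$. The instance is *correlative* if for any two jobs $j,j'$ with $x_j\neq 0$ and $x_{j'}\neq 0$, $a_j\le a_{j'}\iff x_j\le x_{j'}$. The size of an instance is $n+c$ plus the total number of bits of $K$, of the $x_j$, and of the numerators and denominators of the $a_j$. **Theorem (PTAS for correlative single load and minimal cache demand).** There is a polynomial-time approximation scheme for the joint cache partition and job assignment problem restricted to correlative instances with a single load and a minimal cache demand per job. That is, there is an algorithm $A$ (a random access machine program, its running time measured by the logarithmic cost criterion) that takes as input a rational $\varepsilon>0$ and an instance, such that for every fixed rational $\varepsilon>0$ there is a polynomial $q_\varepsilon$ for which, on every correlative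 instance $I$, $A$ halts within time $q_\varepsilon(\mathrm{size}(I))$ and, if $I$ has a solution, outputs a solution $(p,S)$ of makespan at most $(1+\varepsilon)\,m_{\mathrm{opt}}(I)$, where $m_{\mathrm{opt}}(I)$ is the minimum makespan of a solution of $I$ (with the same $K$ cache and $c$ cores). -/

import Mathlib

namespace CacheSched

/-! ### Random access machine with the logarithmic cost criterion

Programs are structured programs over scalar variables and arrays, all holding natural numbers.
Every arithmetic operation and every memory access is charged the bit length of the numbers
involved. -/

/-- A memory: scalar variables and (unbounded) arrays, each kind named by natural numbers. -/
structure Store where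
  var : ℕ → ℕ
  arr : ℕ → ℕ → ℕ

/-- Arithmetic operations: addition, truncated subtraction, multiplication, and integer division
(division by zero returns zero). -/
inductive BinOp
  | add
  | sub
  | mul
  | div

/-- The value of an arithmetic operation. -/
def BinOp.apply : BinOp → ℕ → ℕ → ℕ
  | .add, m, n => m + n
  | .sub, m, n => m - n
  | .mul, m, n => m * n
  | .div, m, n => m / n

/-- Expressions: constants, variables `x`, array cells `a[e]`, and arithmetic operations. -/
inductive Exp
  | const (n : ℕ)
  | var (x : ℕ)
  | read (a : ℕ) (e : Exp)
  | op (o : BinOp) (e₁ e₂ : Exp)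

/-- The value of an expression. -/
def Exp.val (σ : Store) : Exp → ℕ
  | .const n => n
  | .var x => σ.var x
  | .read a e => σ.arr a (e.val σ)
  | .op o e₁ e₂ => o.apply (e₁.val σ) (e₂.val σ)

/-- The logarithmic cost of evaluating an expression: every node of the expression costs one
unit plus the bit length of its value (so operands and addresses are charged as well). -/
def Exp.cost (σ : Store) : Exp → ℕ
  | .const n => 1 + n.size
  | .var x => 1 + (σ.var x).size
  | .read a e => e.cost σ + 1 + (σ.arr a (e.val σ)).size
  | .op o e₁ e₂ => e₁.cost σ + e₂.cost σ + 1 + (o.apply (e₁.val σ) (e₂.val σ)).size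

/-- Programs: `x := e`, `a[i] := e`, sequencing, branching and loops. A condition is an expression,
which counts as true when its value is nonzero. -/
inductive Prog
  | skip
  | assign (x : ℕ) (e : Exp)
  | write (a : ℕ) (i e : Exp)
  | seq (P Q : Prog)
  | ite (b : Exp) (P Q : Prog)
  | loop (b : Exp) (P : Prog)

/-- Set the variable `x` to `v`. -/
def Store.setVar (σ : Store) (x v : ℕ) : Store :=
  { σ with var := Function.update σ.var x v }

/-- Set the cell `i` of the array `a` to `v`. -/
def Store.setArr (σ : Store) (a i v : ℕ) : Store :=
  { σ with arr := Function.update σ.arr a (Function.update (σ.arr a) i v) }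

/-- `Exec P σ t τ`: started in memory `σ`, the program `P` halts after time exactly `t`, with
memory `τ`. -/
inductive Exec : Prog → Store → ℕ → Store → Prop
  | skip (σ : Store) : Exec .skip σ 1 σ
  | assign (σ : Store) (x : ℕ) (e : Exp) :
      Exec (.assign x e) σ (1 + e.cost σ) (σ.setVar x (e.val σ))
  | write (σ : Store) (a : ℕ) (i e : Exp) :
      Exec (.write a i e) σ (1 + i.cost σ + e.cost σ) (σ.setArr a (i.val σ) (e.val σ))
  | seq {P Q : Prog} {σ τ υ : Store} {t u : ℕ} :
      Exec P σ t τ → Exec Q τ u υ → Exec (.seq P Q) σ (t + u) υ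
  | ite_true {b : Exp} {P Q : Prog} {σ τ : Store} {t : ℕ} :
      b.val σ ≠ 0 → Exec P σ t τ → Exec (.ite b P Q) σ (1 + b.cost σ + t) τ
  | ite_false {b : Exp} {P Q : Prog} {σ τ : Store} {t : ℕ} :
      b.val σ = 0 → Exec Q σ t τ → Exec (.ite b P Q) σ (1 + b.cost σ + t) τ
  | loop_true {b : Exp} {P : Prog} {σ τ υ : Store} {t u : ℕ} :
      b.val σ ≠ 0 → Exec P σ t τ → Exec (.loop b P) τ u υ →
        Exec (.loop b P) σ (1 + b.cost σ + t + u) υ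
  | loop_false {b : Exp} {P : Prog} {σ : Store} :
      b.val σ = 0 → Exec (.loop b P) σ (1 + b.cost σ) σ

/-! ### The joint cache partition and job assignment problem with a single load and a minimal
cache demand per job -/

/-- An instance: `n` jobs, `c` cores, `K` cache; job `j` has load `load j`, and must run on a core
with at least `demand j` cache. -/
structure Inst where
  n : ℕ
  c : ℕ
  K : ℕ
  load : Fin n → ℚ≥0
  demand : Fin n → ℕ

/-- Any two jobs with nonzero cache demand are ordered by load exactly as by cache demand. -/
def Inst.Correlative (I : Inst) : Prop :=
  ∀ j j' : Fin I.n, I.demand j ≠ 0 → I.demand j' ≠ 0 →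
    (I.load j ≤ I.load j' ↔ I.demand j ≤ I.demand j')

/-- A solution: a partition of the `K` cache among the cores, and an assignment of the jobs to
cores in which the cache demand of every job is met. -/
structure Sol (I : Inst) where
  cache : Fin I.c → ℕ
  core : Fin I.n → Fin I.c
  cache_sum : ∑ i, cache i = I.K
  demand_le : ∀ j, I.demand j ≤ cache (core j)

/-- The makespan of a solution: the largest total load of the jobs on one core. -/
def Sol.makespan {I : Inst} (s : Sol I) : ℚ≥0 :=
  Finset.univ.sup fun i : Fin I.c => ∑ j with s.core j = i, I.load j

/-- The size of an instance: the number of jobs, plus the number of cores, plus the bit lengths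
of the cache size and of the loads (numerators and denominators) and cache demands. -/
def Inst.size (I : Inst) : ℕ :=
  I.n + I.c + I.K.size +
    ∑ j, ((I.load j).num.size + (I.load j).den.size + (I.demand j).size)

/-- The initial memory on the instance `I` and the accuracy `ε`: variables `0, …, 4` hold
`n`, `c`, `K` and the numerator and denominator of `ε`; arrays `0`, `1`, `2` hold the numerators
and denominators of the loads and the cache demands; everything else is zero. -/
def Inst.input (I : Inst) (ε : ℚ≥0) : Store where
  var x :=
    match x with
    | 0 => I.n
    | 1 => I.c
    | 2 => I.K
    | 3 => ε.num
    | 4 => ε.den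
    | _ => 0
  arr a i :=
    if h : i < I.n then
      match a with
      | 0 => (I.load ⟨i, h⟩).num
      | 1 => (I.load ⟨i, h⟩).den
      | 2 => I.demand ⟨i, h⟩
      | _ => 0
    else 0

/-- The memory `σ` holds the solution `s`: array `3` lists the cache of the cores, and array `4`
lists the core of each job. -/
def Sol.IsOutput {I : Inst} (s : Sol I) (σ : Store) : Prop :=
  (∀ i : Fin I.c, σ.arr 3 i = s.cache i) ∧ ∀ j : Fin I.n, σ.arr 4 j = (s.core j : ℕ)

end CacheSched

namespace CacheSched

/-! ### Sized memories and expressions -/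

/-- Every number held in the memory has at most `s` bits. -/
def Store.Sized (σ : Store) (s : ℕ) : Prop :=
  (∀ x, (σ.var x).size ≤ s) ∧ ∀ a i, (σ.arr a i).size ≤ s

/-- The variables in `F` and the arrays in `G` hold numbers of at most `b` bits. -/
def Store.StaticSized (σ : Store) (F G : List ℕ) (b : ℕ) : Prop :=
  (∀ x ∈ F, (σ.var x).size ≤ b) ∧ ∀ a ∈ G, ∀ i, (σ.arr a i).size ≤ b

theorem Store.Sized.mono {σ : Store} {s s' : ℕ} (h : σ.Sized s) (hs : s ≤ s') : σ.Sized s' :=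
  ⟨fun x => (h.1 x).trans hs, fun a i => (h.2 a i).trans hs⟩

theorem Store.Sized.setVar {σ : Store} {s x v : ℕ} (h : σ.Sized s) (hv : v.size ≤ s) :
    (σ.setVar x v).Sized s := by
  refine ⟨fun y => ?_, h.2⟩
  by_cases hy : y = x
  · subst hy; simpa [Store.setVar] using hv
  · simpa [Store.setVar, Function.update_of_ne hy] using h.1 y

theorem Store.Sized.setArr {σ : Store} {s a i v : ℕ} (h : σ.Sized s) (hv : v.size ≤ s) :
    (σ.setArr a i v).Sized s := by
  refine ⟨h.1, fun a' i' => ?_⟩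
  by_cases ha : a' = a
  · subst ha
    by_cases hi : i' = i
    · subst hi; simpa [Store.setArr] using hv
    · simpa [Store.setArr, Function.update_of_ne hi] using h.2 a' i'
  · simpa [Store.setArr, Function.update_of_ne ha] using h.2 a' i'

/-- The weight of an expression: its number of nodes plus the bits of its constants. -/
def Exp.weight : Exp → ℕ
  | .const n => 1 + n.size
  | .var _ => 1
  | .read _ e => e.weight + 1
  | .op _ e₁ e₂ => e₁.weight + e₂.weight + 1

/-- A constant, a variable in `F` or a cell of an array in `G`. -/
def Exp.isStatic (F G : List ℕ) : Exp → Bool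
  | .const _ => true
  | .var x => decide (x ∈ F)
  | .read a _ => decide (a ∈ G)
  | .op _ _ _ => false

/-- In every multiplication, the right factor is a constant or lies in `F` or `G`. -/
def Exp.ok (F G : List ℕ) : Exp → Bool
  | .const _ => true
  | .var _ => true
  | .read _ e => e.ok F G
  | .op .mul e₁ e₂ => e₁.ok F G && e₂.ok F G && e₂.isStatic F G
  | .op _ e₁ e₂ => e₁.ok F G && e₂.ok F G

theorem size_add_le (m n : ℕ) : (m + n).size ≤ max m.size n.size + 1 := by
  rw [Nat.size_le, pow_succ]
  have h1 : m < 2 ^ max m.size n.size :=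
    (Nat.lt_size_self m).trans_le (Nat.pow_le_pow_right (by norm_num) (le_max_left _ _))
  have h2 : n < 2 ^ max m.size n.size :=
    (Nat.lt_size_self n).trans_le (Nat.pow_le_pow_right (by norm_num) (le_max_right _ _))
  omega

theorem size_mul_le (m n : ℕ) : (m * n).size ≤ m.size + n.size := by
  rw [Nat.size_le, pow_add]
  exact Nat.mul_lt_mul'' (Nat.lt_size_self m) (Nat.lt_size_self n)

theorem size_le_self (n : ℕ) : n.size ≤ n := by
  rw [Nat.size_le]; exact Nat.lt_two_pow_self

theorem Exp.size_val_of_isStatic {F G : List ℕ} {σ : Store} {b : ℕ} (hb : σ.StaticSized F G b)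
    {e : Exp} (he : e.isStatic F G = true) : (e.val σ).size ≤ e.weight * (b + 1) := by
  cases e with
  | const n => simp only [Exp.val, Exp.weight]; nlinarith [Nat.zero_le (n.size * b)]
  | var x =>
    have := hb.1 x (by simpa [Exp.isStatic] using he)
    simp only [Exp.val, Exp.weight]; omega
  | read a e =>
    have := hb.2 a (by simpa [Exp.isStatic] using he) (e.val σ)
    simp only [Exp.val, Exp.weight]; nlinarith [Nat.zero_le (e.weight * (b + 1))]
  | op o e₁ e₂ => simp [Exp.isStatic] at he

theorem Exp.size_val_le {F G : List ℕ} {σ : Store} {b s : ℕ} (hs : σ.Sized s)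
    (hb : σ.StaticSized F G b) (e : Exp) (he : e.ok F G = true) :
    (e.val σ).size ≤ s + e.weight * (b + 1) := by
  induction e with
  | const n =>
    have := Exp.size_val_of_isStatic hb (e := .const n) rfl
    omega
  | var x => exact (hs.1 x).trans (Nat.le_add_right _ _)
  | read a e ih => exact (hs.2 a _).trans (Nat.le_add_right _ _)
  | op o e₁ e₂ ih₁ ih₂ =>
    cases o with
    | add =>
      simp only [Exp.ok, Bool.and_eq_true] at he
      have h1 := ih₁ he.1
      have h2 := ih₂ he.2
      have := size_add_le (e₁.val σ) (e₂.val σ)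
      simp only [Exp.val, BinOp.apply, Exp.weight]
      have h3 : max (e₁.val σ).size (e₂.val σ).size ≤ s + (e₁.weight + e₂.weight) * (b + 1) := by
        apply max_le <;> nlinarith [Nat.zero_le (e₁.weight * (b + 1)), Nat.zero_le (e₂.weight * (b + 1))]
      nlinarith
    | sub =>
      simp only [Exp.ok, Bool.and_eq_true] at he
      have h1 := ih₁ he.1
      have : (e₁.val σ - e₂.val σ).size ≤ (e₁.val σ).size := Nat.size_le_size (Nat.sub_le _ _)
      simp only [Exp.val, BinOp.apply, Exp.weight]
      nlinarith [Nat.zero_le (e₂.weight * (b + 1))]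
    | mul =>
      simp only [Exp.ok, Bool.and_eq_true] at he
      have h1 := ih₁ he.1.1
      have h2 := Exp.size_val_of_isStatic hb he.2
      have := size_mul_le (e₁.val σ) (e₂.val σ)
      simp only [Exp.val, BinOp.apply, Exp.weight]
      nlinarith
    | div =>
      simp only [Exp.ok, Bool.and_eq_true] at he
      have h1 := ih₁ he.1
      have : (e₁.val σ / e₂.val σ).size ≤ (e₁.val σ).size := Nat.size_le_size (Nat.div_le_self _ _)
      simp only [Exp.val, BinOp.apply, Exp.weight]
      nlinarith [Nat.zero_le (e₂.weight * (b + 1))]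

theorem work_add_le (k₁ k₂ s b : ℕ) :
    k₁ * (s + k₁ * (b + 1) + 1) + k₂ * (s + k₁ * (b + 1) + k₂ * (b + 1) + 1) ≤
      (k₁ + k₂) * (s + (k₁ + k₂) * (b + 1) + 1) := by
  nlinarith [Nat.zero_le (k₁ * k₂ * (b + 1))]

theorem work_mono {k k' s s' b : ℕ} (hk : k ≤ k') (hs : s ≤ s') :
    k * (s + k * (b + 1) + 1) ≤ k' * (s' + k' * (b + 1) + 1) := by
  gcongr

theorem Exp.cost_le {F G : List ℕ} {σ : Store} {b s : ℕ} (hs : σ.Sized s)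
    (hb : σ.StaticSized F G b) (e : Exp) (he : e.ok F G = true) :
    e.cost σ ≤ e.weight * (s + e.weight * (b + 1) + 1) := by
  induction e with
  | const n => simp only [Exp.cost, Exp.weight]; nlinarith [Nat.zero_le ((1 + n.size) * (s + (1 + n.size) * (b + 1)))]
  | var x => have := hs.1 x; simp only [Exp.cost, Exp.weight]; omega
  | read a e ih =>
    have h1 := ih he
    have h2 := hs.2 a (e.val σ)
    simp only [Exp.cost, Exp.weight]
    nlinarith [work_add_le e.weight 1 s b]
  | op o e₁ e₂ ih₁ ih₂ =>
    have hv := Exp.size_val_le hs hb _ he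
    have hh : e₁.ok F G = true ∧ e₂.ok F G = true := by
      cases o <;> simp only [Exp.ok, Bool.and_eq_true] at he <;> tauto
    have h1 := ih₁ hh.1
    have h2 := ih₂ hh.2
    simp only [Exp.cost, Exp.weight] at hv ⊢
    have h3 := work_add_le e₁.weight e₂.weight s b
    have h4 := work_add_le (e₁.weight + e₂.weight) 1 s b
    have h5 : e₂.weight * (s + e₂.weight * (b + 1) + 1) ≤
      e₂.weight * (s + e₁.weight * (b + 1) + e₂.weight * (b + 1) + 1) := by gcongr; omega
    simp only [Exp.val] at hv
    nlinarith

/-! ### Programs with bounded loops -/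

/-- Programs in which the only loops are counting loops `for x < y`. -/
inductive LProg
  | skip
  | assign (x : ℕ) (e : Exp)
  | write (a : ℕ) (i e : Exp)
  | seq (P Q : LProg)
  | ite (b : Exp) (P Q : LProg)
  | upto (x y : ℕ) (P : LProg)

/-- The translation into general programs. -/
def LProg.compile : LProg → Prog
  | .skip => .skip
  | .assign x e => .assign x e
  | .write a i e => .write a i e
  | .seq P Q => .seq P.compile Q.compile
  | .ite b P Q => .ite b P.compile Q.compile
  | .upto x y P => .seq (.assign x (.const 0))
      (.loop (.op .sub (.var y) (.var x))
        (.seq P.compile (.assign x (.op .add (.var x) (.const 1)))))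

/-- The memory after running a program with bounded loops. -/
def LProg.eval : LProg → Store → Store
  | .skip, σ => σ
  | .assign x e, σ => σ.setVar x (e.val σ)
  | .write a i e, σ => σ.setArr a (i.val σ) (e.val σ)
  | .seq P Q, σ => Q.eval (P.eval σ)
  | .ite b P Q, σ => if b.val σ = 0 then Q.eval σ else P.eval σ
  | .upto x y P, σ =>
      (fun τ => (P.eval τ).setVar x (τ.var x + 1))^[σ.var y] (σ.setVar x 0)

/-- The variables that a program may change. -/
def LProg.modVar : LProg → List ℕ
  | .skip => []
  | .assign x _ => [x]
  | .write _ _ _ => []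
  | .seq P Q => P.modVar ++ Q.modVar
  | .ite _ P Q => P.modVar ++ Q.modVar
  | .upto x _ P => x :: P.modVar

/-- The arrays that a program may change. -/
def LProg.modArr : LProg → List ℕ
  | .skip => []
  | .assign _ _ => []
  | .write a _ _ => [a]
  | .seq P Q => P.modArr ++ Q.modArr
  | .ite _ P Q => P.modArr ++ Q.modArr
  | .upto _ _ P => P.modArr

theorem LProg.eval_var_of_notMem (P : LProg) : ∀ (σ : Store) (z : ℕ), z ∉ P.modVar →
    (P.eval σ).var z = σ.var z := by
  induction P with
  | skip => intros; rfl
  | assign x e =>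
    intro σ z hz
    simp only [modVar, List.mem_singleton] at hz
    simp [eval, Store.setVar, Function.update_of_ne hz]
  | write a i e => intros; rfl
  | seq P Q ihP ihQ =>
    intro σ z hz
    simp only [modVar, List.mem_append, not_or] at hz
    simp [eval, ihP _ _ hz.1, ihQ _ _ hz.2]
  | ite b P Q ihP ihQ =>
    intro σ z hz
    simp only [modVar, List.mem_append, not_or] at hz
    simp only [eval]
    split_ifs
    · exact ihQ _ _ hz.2
    · exact ihP _ _ hz.1
  | upto x y P ih =>
    intro σ z hz
    simp only [modVar, List.mem_cons, not_or] at hz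
    simp only [eval]
    generalize σ.var y = m
    induction m with
    | zero => simp [Store.setVar, Function.update_of_ne hz.1]
    | succ m ihm =>
      rw [Function.iterate_succ_apply']
      simp only [Store.setVar, Function.update_of_ne hz.1] at ihm ⊢
      rw [ih _ _ hz.2]; exact ihm

theorem LProg.eval_arr_of_notMem (P : LProg) : ∀ (σ : Store) (a : ℕ), a ∉ P.modArr →
    (P.eval σ).arr a = σ.arr a := by
  induction P with
  | skip => intros; rfl
  | assign x e => intros; rfl
  | write b i e =>
    intro σ a ha
    simp only [modArr, List.mem_singleton] at ha
    simp [eval, Store.setArr, Function.update_of_ne ha]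
  | seq P Q ihP ihQ =>
    intro σ z hz
    simp only [modArr, List.mem_append, not_or] at hz
    simp [eval, ihP _ _ hz.1, ihQ _ _ hz.2]
  | ite b P Q ihP ihQ =>
    intro σ z hz
    simp only [modArr, List.mem_append, not_or] at hz
    simp only [eval]
    split_ifs
    · exact ihQ _ _ hz.2
    · exact ihP _ _ hz.1
  | upto x y P ih =>
    intro σ z hz
    simp only [modArr] at hz
    simp only [eval]
    generalize σ.var y = m
    induction m with
    | zero => simp [Store.setVar]
    | succ m ihm =>
      rw [Function.iterate_succ_apply']
      simp only [Store.setVar] at ihm ⊢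
      rw [ih _ _ hz]; exact ihm

/-- The syntactic conditions under which a program runs in polynomial time: the variables in
`F` and `H` and the arrays in `G` are not changed, right factors lie in `F` or `G`, the limits
of the loops lie in `H`, and loop bodies do not change the loop counter. -/
def LProg.ok (F G H : List ℕ) : LProg → Bool
  | .skip => true
  | .assign x e => decide (x ∉ F) && decide (x ∉ H) && e.ok F G
  | .write a i e => decide (a ∉ G) && i.ok F G && e.ok F G
  | .seq P Q => P.ok F G H && Q.ok F G H
  | .ite b P Q => b.ok F G && P.ok F G H && Q.ok F G H
  | .upto x y P => decide (x ∉ F) && decide (x ∉ H) && decide (y ∈ H) &&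
      decide (x ∉ P.modVar) && P.ok F G H

/-- A bound for the weight of the expressions evaluated by a program whose loops run for at most
`M` rounds. -/
def LProg.work (M : ℕ) : LProg → ℕ
  | .skip => 1
  | .assign _ e => e.weight + 1
  | .write _ i e => i.weight + e.weight + 1
  | .seq P Q => P.work M + Q.work M
  | .ite b P Q => b.weight + 1 + P.work M + Q.work M
  | .upto _ _ P => 7 + M * (P.work M + 9)

theorem LProg.exists_polynomial_work (P : LProg) :
    ∃ p : Polynomial ℕ, ∀ M, P.work M = p.eval M := by
  induction P with
  | skip => exact ⟨1, by simp [work]⟩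
  | assign x e => exact ⟨Polynomial.C (e.weight + 1), by simp [work]⟩
  | write a i e => exact ⟨Polynomial.C (i.weight + e.weight + 1), by simp [work]⟩
  | seq P Q ihP ihQ =>
    obtain ⟨p, hp⟩ := ihP
    obtain ⟨r, hr⟩ := ihQ
    exact ⟨p + r, by simp [work, hp, hr]⟩
  | ite b P Q ihP ihQ =>
    obtain ⟨p, hp⟩ := ihP
    obtain ⟨r, hr⟩ := ihQ
    exact ⟨Polynomial.C (b.weight + 1) + p + r, by simp [work, hp, hr]⟩
  | upto x y P ih =>
    obtain ⟨p, hp⟩ := ih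
    exact ⟨Polynomial.C 7 + Polynomial.X * (p + Polynomial.C 9), by simp [work, hp]⟩

theorem LProg.notMem_modVar_of_ok {F G H : List ℕ} : ∀ {P : LProg}, P.ok F G H = true →
    ∀ x ∈ P.modVar, x ∉ F ∧ x ∉ H := by
  intro P
  induction P with
  | skip => simp [modVar]
  | assign x e => intro h; simp_all [ok, modVar]
  | write a i e => simp [modVar]
  | seq P Q ihP ihQ =>
    intro h x hx
    simp only [ok, Bool.and_eq_true] at h
    rcases List.mem_append.1 hx with hx | hx
    · exact ihP h.1 x hx
    · exact ihQ h.2 x hx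
  | ite b P Q ihP ihQ =>
    intro h x hx
    simp only [ok, Bool.and_eq_true] at h
    rcases List.mem_append.1 hx with hx | hx
    · exact ihP h.1.2 x hx
    · exact ihQ h.2 x hx
  | upto y z P ih =>
    intro h x hx
    simp only [ok, Bool.and_eq_true, decide_eq_true_eq] at h
    rcases List.mem_cons.1 hx with hx | hx
    · subst hx; exact h.1.1.1
    · exact ih h.2 x hx

theorem LProg.notMem_modArr_of_ok {F G H : List ℕ} : ∀ {P : LProg}, P.ok F G H = true →
    ∀ a ∈ P.modArr, a ∉ G := by
  intro P
  induction P with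
  | skip => simp [modArr]
  | assign x e => simp [modArr]
  | write a i e => intro h; simp_all [ok, modArr]
  | seq P Q ihP ihQ =>
    intro h x hx
    simp only [ok, Bool.and_eq_true] at h
    rcases List.mem_append.1 hx with hx | hx
    · exact ihP h.1 x hx
    · exact ihQ h.2 x hx
  | ite b P Q ihP ihQ =>
    intro h x hx
    simp only [ok, Bool.and_eq_true] at h
    rcases List.mem_append.1 hx with hx | hx
    · exact ihP h.1.2 x hx
    · exact ihQ h.2 x hx
  | upto y z P ih =>
    intro h x hx
    simp only [ok, Bool.and_eq_true, decide_eq_true_eq] at h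
    exact ih h.2 x hx

/-- The hypotheses on the initial memory for the running time bound. -/
structure Store.Static (σ : Store) (F G H : List ℕ) (b M : ℕ) : Prop where
  sized : σ.StaticSized F G b
  limit : ∀ y ∈ H, σ.var y ≤ M

theorem Store.Static.eval {σ : Store} {F G H : List ℕ} {b M : ℕ} (h : σ.Static F G H b M)
    {P : LProg} (hP : P.ok F G H = true) : (P.eval σ).Static F G H b M := by
  refine ⟨⟨fun x hx => ?_, fun a ha i => ?_⟩, fun y hy => ?_⟩
  · rw [P.eval_var_of_notMem σ x fun hm => (LProg.notMem_modVar_of_ok hP x hm).1 hx]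
    exact h.sized.1 x hx
  · rw [P.eval_arr_of_notMem σ a fun hm => LProg.notMem_modArr_of_ok hP a hm ha]
    exact h.sized.2 a ha i
  · rw [P.eval_var_of_notMem σ y fun hm => (LProg.notMem_modVar_of_ok hP y hm).2 hy]
    exact h.limit y hy

theorem Store.Static.setVar {σ : Store} {F G H : List ℕ} {b M x v : ℕ} (h : σ.Static F G H b M)
    (hF : x ∉ F) (hH : x ∉ H) : (σ.setVar x v).Static F G H b M := by
  refine ⟨⟨fun y hy => ?_, h.sized.2⟩, fun y hy => ?_⟩
  · have : y ≠ x := fun e => hF (e ▸ hy)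
    simpa [Store.setVar, Function.update_of_ne this] using h.sized.1 y hy
  · have : y ≠ x := fun e => hH (e ▸ hy)
    simpa [Store.setVar, Function.update_of_ne this] using h.limit y hy

/-- The program `P` started in `σ`, whose numbers have at most `s` bits, halts in `τ`, and the
time and the bits of the numbers in `τ` are bounded in terms of the work `k`. -/
def RunsWithin (P : Prog) (σ τ : Store) (k s b : ℕ) : Prop :=
  ∃ t, Exec P σ t τ ∧ t ≤ k * (s + k * (b + 1) + 1) ∧ τ.Sized (s + k * (b + 1))

theorem RunsWithin.mono {P : Prog} {σ τ : Store} {k k' s b : ℕ} (h : RunsWithin P σ τ k s b)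
    (hk : k ≤ k') : RunsWithin P σ τ k' s b := by
  obtain ⟨t, ht, hle, hs⟩ := h
  exact ⟨t, ht, hle.trans (work_mono hk le_rfl), hs.mono (by gcongr)⟩

theorem RunsWithin.seq {P Q : Prog} {σ τ υ : Store} {k₁ k₂ s b : ℕ}
    (h₁ : RunsWithin P σ τ k₁ s b) (h₂ : RunsWithin Q τ υ k₂ (s + k₁ * (b + 1)) b) :
    RunsWithin (.seq P Q) σ υ (k₁ + k₂) s b := by
  obtain ⟨t₁, ht₁, hle₁, hs₁⟩ := h₁
  obtain ⟨t₂, ht₂, hle₂, hs₂⟩ := h₂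
  refine ⟨t₁ + t₂, .seq ht₁ ht₂, (Nat.add_le_add hle₁ hle₂).trans (work_add_le ..), ?_⟩
  exact hs₂.mono (by ring_nf; rfl)

theorem RunsWithin.assign {F G : List ℕ} {σ : Store} {b s : ℕ} (hs : σ.Sized s)
    (hb : σ.StaticSized F G b) (x : ℕ) (e : Exp) (he : e.ok F G = true) :
    RunsWithin (.assign x e) σ (σ.setVar x (e.val σ)) (e.weight + 1) s b := by
  refine ⟨_, .assign σ x e, ?_, (hs.mono (Nat.le_add_right _ _)).setVar ?_⟩
  · have := Exp.cost_le hs hb e he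
    nlinarith [work_add_le e.weight 1 s b]
  · refine (Exp.size_val_le hs hb e he).trans ?_
    gcongr; omega

/-- Translated programs halt in the memory given by `LProg.eval`, in bounded time. -/
theorem LProg.runsWithin {F G H : List ℕ} {b M : ℕ} (P : LProg) (hP : P.ok F G H = true) :
    ∀ (σ : Store) (s : ℕ), σ.Sized s → σ.Static F G H b M →
      RunsWithin P.compile σ (P.eval σ) (P.work M) s b := by
  induction P with
  | skip =>
    intro σ s hs hb
    exact ⟨1, .skip σ, by simp [work], hs.mono (Nat.le_add_right _ _)⟩
  | assign x e =>
    intro σ s hs hb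
    simp only [ok, Bool.and_eq_true] at hP
    exact .assign hs hb.sized x e hP.2
  | write a i e =>
    intro σ s hs hb
    simp only [ok, Bool.and_eq_true] at hP
    refine ⟨_, .write σ a i e, ?_, (hs.mono (Nat.le_add_right _ _)).setArr ?_⟩
    · have h1 := Exp.cost_le hs hb.sized i hP.1.2
      have h2 := Exp.cost_le hs hb.sized e hP.2
      simp only [work]
      have h3 := work_add_le i.weight e.weight s b
      have h4 := work_add_le (i.weight + e.weight) 1 s b
      have h5 : e.weight * (s + e.weight * (b + 1) + 1) ≤
        e.weight * (s + i.weight * (b + 1) + e.weight * (b + 1) + 1) := by gcongr; omega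
      nlinarith
    · refine (Exp.size_val_le hs hb.sized e hP.2).trans ?_
      simp only [work]
      gcongr; omega
  | seq P Q ihP ihQ =>
    intro σ s hs hb
    simp only [ok, Bool.and_eq_true] at hP
    have h := ihP hP.1 σ s hs hb
    obtain ⟨_, _, _, hs'⟩ := id h
    exact h.seq (ihQ hP.2 _ _ hs' (hb.eval hP.1))
  | ite e P Q ihP ihQ =>
    intro σ s hs hb
    simp only [ok, Bool.and_eq_true] at hP
    have h1 := Exp.cost_le hs hb.sized e hP.1.1
    have key : ∀ k t, k ≤ P.work M + Q.work M → t ≤ k * (s + k * (b + 1) + 1) →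
        1 + e.cost σ + t ≤ (LProg.ite e P Q).work M * (s + (LProg.ite e P Q).work M * (b + 1) + 1) := by
      intro k t hk ht
      have h2 := work_add_le e.weight 1 s b
      have h3 := work_add_le (e.weight + 1) k s b
      have h4 := work_mono (s := s) (b := b) (show e.weight + 1 + k ≤ (LProg.ite e P Q).work M by
        simp only [work]; omega) le_rfl
      have h5 : k * (s + k * (b + 1) + 1) ≤
        k * (s + (e.weight + 1) * (b + 1) + k * (b + 1) + 1) := by gcongr; omega
      nlinarith
    simp only [LProg.eval, LProg.compile]
    split_ifs with h0
    · obtain ⟨t, ht, hle, hs'⟩ := ihQ hP.2 σ s hs hb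
      exact ⟨_, .ite_false h0 ht, key _ _ (by omega) hle, hs'.mono (by simp only [work]; gcongr; omega)⟩
    · obtain ⟨t, ht, hle, hs'⟩ := ihP hP.1.2 σ s hs hb
      exact ⟨_, .ite_true h0 ht, key _ _ (by omega) hle, hs'.mono (by simp only [work]; gcongr; omega)⟩
  | upto x y P ih =>
    intro σ s hs hb
    simp only [ok, Bool.and_eq_true, decide_eq_true_eq] at hP
    obtain ⟨⟨⟨⟨hxF, hxH⟩, hyH⟩, hxP⟩, hokP⟩ := hP
    have hyx : y ≠ x := fun e => hxH (e ▸ hyH)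
    have hinc : (Exp.op .add (.var x) (.const 1)).ok F G = true := by simp [Exp.ok]
    have hcond : (Exp.op .sub (.var y) (.var x)).ok F G = true := by simp [Exp.ok]
    set Bd : Store → Store := fun τ => (P.eval τ).setVar x (τ.var x + 1) with hBd
    have hstep : ∀ τ s', τ.Sized s' → τ.Static F G H b M →
        RunsWithin (.seq P.compile (.assign x (.op .add (.var x) (.const 1)))) τ (Bd τ)
          (P.work M + 5) s' b := by
      intro τ s' hs' hb'
      have h := ih hokP τ s' hs' hb'
      obtain ⟨_, _, _, hs''⟩ := id h
      have h2 := RunsWithin.assign hs'' (hb'.eval hokP).sized x _ hinc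
      have h3 := h.seq h2
      simpa [hBd, Exp.val, BinOp.apply, Exp.weight, P.eval_var_of_notMem τ x hxP] using h3
    have hloop : ∀ m, m ≤ M → ∀ τ s', τ.Sized s' → τ.Static F G H b M → τ.var y = τ.var x + m →
        RunsWithin (.loop (.op .sub (.var y) (.var x))
          (.seq P.compile (.assign x (.op .add (.var x) (.const 1))))) τ (Bd^[m] τ)
          (4 + m * (P.work M + 9)) s' b := by
      intro m
      induction m with
      | zero =>
        intro _ τ s' hs' hb' hm
        have h1 := Exp.cost_le hs' hb'.sized _ hcond
        refine ⟨_, .loop_false (by simp [Exp.val, BinOp.apply, hm]), ?_,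
          hs'.mono (Nat.le_add_right _ _)⟩
        simp only [Exp.weight] at h1
        nlinarith
      | succ m ihm =>
        intro hm τ s' hs' hb' hv
        have h1 := Exp.cost_le hs' hb'.sized _ hcond
        have hb1 := hstep τ s' hs' hb'
        obtain ⟨t₁, ht₁, hle₁, hs₁⟩ := hb1
        have hvx : (Bd τ).var x = τ.var x + 1 := by simp [hBd, Store.setVar]
        have hvy : (Bd τ).var y = τ.var y := by
          simp only [hBd, Store.setVar, Function.update_of_ne hyx]
          exact P.eval_var_of_notMem τ y fun h => (LProg.notMem_modVar_of_ok hokP y h).2 hyH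
        have hb2 : (Bd τ).Static F G H b M := (hb'.eval hokP).setVar hxF hxH
        obtain ⟨t₂, ht₂, hle₂, hs₂⟩ := ihm (by omega) (Bd τ) _ hs₁ hb2 (by omega)
        refine ⟨_, .loop_true (by simp [Exp.val, BinOp.apply, hv]) ht₁ ht₂, ?_, ?_⟩
        · have h2 := work_add_le (P.work M + 5) (4 + m * (P.work M + 9)) s' b
          have h3 := work_add_le 4 (P.work M + 5 + (4 + m * (P.work M + 9))) s' b
          simp only [Exp.weight] at h1
          have h4 : 4 + (m + 1) * (P.work M + 9) =
            4 + (P.work M + 5 + (4 + m * (P.work M + 9))) := by ring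
          generalize P.work M + 5 + (4 + m * (P.work M + 9)) = k at *
          rw [h4]
          have h5 : k * (s' + k * (b + 1) + 1) ≤ k * (s' + 4 * (b + 1) + k * (b + 1) + 1) := by
            gcongr; omega
          nlinarith
        · rw [Function.iterate_succ_apply]
          refine hs₂.mono ?_
          have : P.work M + 5 + (4 + m * (P.work M + 9)) ≤ 4 + (m + 1) * (P.work M + 9) := by
            ring_nf; omega
          nlinarith
    have h0 := RunsWithin.assign hs hb.sized x (.const 0) rfl
    obtain ⟨_, _, _, hs'⟩ := id h0
    have h1 := hloop (σ.var y) (hb.limit y hyH) _ _ hs' (hb.setVar hxF hxH)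
      (by simp [Store.setVar, Function.update_of_ne hyx, Exp.val])
    refine (h0.seq h1).mono ?_
    have : σ.var y * (P.work M + 9) ≤ M * (P.work M + 9) := by gcongr; exact hb.limit y hyH
    simp only [work, Exp.weight, Nat.size_zero]
    omega

/-! ### The program -/

instance : Add Exp := ⟨.op .add⟩
instance : Sub Exp := ⟨.op .sub⟩
instance : Mul Exp := ⟨.op .mul⟩
instance : Div Exp := ⟨.op .div⟩

@[simp] theorem Exp.val_const (σ : Store) (n : ℕ) : (Exp.const n).val σ = n := rfl
@[simp] theorem Exp.val_var (σ : Store) (x : ℕ) : (Exp.var x).val σ = σ.var x := rfl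
@[simp] theorem Exp.val_read (σ : Store) (a : ℕ) (e : Exp) :
    (Exp.read a e).val σ = σ.arr a (e.val σ) := rfl
@[simp] theorem Exp.val_add (σ : Store) (e f : Exp) : (e + f).val σ = e.val σ + f.val σ := rfl
@[simp] theorem Exp.val_sub (σ : Store) (e f : Exp) : (e - f).val σ = e.val σ - f.val σ := rfl
@[simp] theorem Exp.val_mul (σ : Store) (e f : Exp) : (e * f).val σ = e.val σ * f.val σ := rfl
@[simp] theorem Exp.val_div (σ : Store) (e f : Exp) : (e / f).val σ = e.val σ / f.val σ := rfl

@[simp] theorem Store.setVar_arr (σ : Store) (x v : ℕ) : (σ.setVar x v).arr = σ.arr := rfl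
@[simp] theorem Store.setArr_var (σ : Store) (a i v : ℕ) : (σ.setArr a i v).var = σ.var := rfl
@[simp] theorem Store.setVar_var (σ : Store) (x v y : ℕ) :
    (σ.setVar x v).var y = if y = x then v else σ.var y := by
  simp [Store.setVar, Function.update_apply]
@[simp] theorem Store.setArr_arr (σ : Store) (a i v a' : ℕ) :
    (σ.setArr a i v).arr a' = if a' = a then Function.update (σ.arr a) i v else σ.arr a' := by
  by_cases h : a' = a
  · subst h; simp [Store.setArr]
  · simp [Store.setArr, h]

theorem Store.ite_var (p : Prop) [Decidable p] (σ τ : Store) (x : ℕ) :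
    (if p then σ else τ).var x = if p then σ.var x else τ.var x := by split_ifs <;> rfl
theorem Store.ite_arr (p : Prop) [Decidable p] (σ τ : Store) (a : ℕ) :
    (if p then σ else τ).arr a = if p then σ.arr a else τ.arr a := by split_ifs <;> rfl

@[simp] theorem LProg.eval_skip (σ : Store) : LProg.skip.eval σ = σ := rfl
@[simp] theorem LProg.eval_assign (σ : Store) (x : ℕ) (e : Exp) :
    (LProg.assign x e).eval σ = σ.setVar x (e.val σ) := rfl
@[simp] theorem LProg.eval_write (σ : Store) (a : ℕ) (i e : Exp) :
    (LProg.write a i e).eval σ = σ.setArr a (i.val σ) (e.val σ) := rfl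
@[simp] theorem LProg.eval_seq (σ : Store) (P Q : LProg) :
    (LProg.seq P Q).eval σ = Q.eval (P.eval σ) := rfl
theorem LProg.eval_ite (σ : Store) (b : Exp) (P Q : LProg) :
    (LProg.ite b P Q).eval σ = if b.val σ = 0 then Q.eval σ else P.eval σ := rfl

/-- The rule for counting loops: an invariant of the rounds, with the frame of the loop. -/
theorem LProg.eval_upto {x y : ℕ} {P : LProg} {σ : Store}
    (Inv : ℕ → Store → Prop) (h0 : Inv 0 (σ.setVar x 0))
    (hs : ∀ i < σ.var y, ∀ τ : Store, τ.var x = i →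
      (∀ z, z ∉ x :: P.modVar → τ.var z = σ.var z) → (∀ a, a ∉ P.modArr → τ.arr a = σ.arr a) →
      Inv i τ → Inv (i + 1) ((P.eval τ).setVar x (i + 1))) :
    Inv (σ.var y) ((LProg.upto x y P).eval σ) := by
  simp only [eval]
  have key : ∀ m ≤ σ.var y, ∀ υ, υ = (fun τ => (P.eval τ).setVar x (τ.var x + 1))^[m]
      (σ.setVar x 0) → υ.var x = m ∧ (∀ z, z ∉ x :: P.modVar → υ.var z = σ.var z) ∧
      (∀ a, a ∉ P.modArr → υ.arr a = σ.arr a) ∧ Inv m υ := by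
    intro m
    induction m with
    | zero =>
      rintro - υ rfl
      refine ⟨by simp, fun z hz => ?_, fun a _ => by simp, h0⟩
      simp only [List.mem_cons, not_or] at hz
      simp [hz.1]
    | succ m ih =>
      rintro hm υ rfl
      obtain ⟨h1, h2, h3, h4⟩ := ih (by omega) _ rfl
      rw [Function.iterate_succ_apply']
      generalize (fun τ => (P.eval τ).setVar x (τ.var x + 1))^[m] (σ.setVar x 0) = τ at *
      refine ⟨by simp [h1], fun z hz => ?_, fun a ha => ?_, ?_⟩
      · have hz' := hz
        simp only [List.mem_cons, not_or] at hz'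
        simp [hz'.1, P.eval_var_of_notMem τ z hz'.2, h2 z hz]
      · simp [P.eval_arr_of_notMem τ a ha, h3 a ha]
      · rw [h1]; exact hs m (by omega) τ h1 h2 h3 h4
  exact (key _ le_rfl _ rfl).2.2.2

namespace PTAS

open LProg Exp

/-! The variables `0, …, 4` hold the input; `5` is the precision `q`; `6` the number of load
levels; `7` the base `c + 1` of the codes of states; `8` the number of codes; `9` the number
`n * q + 1` of candidate makespans; `10` the common denominator; `11` the largest load (at least
one); `12` the candidate makespan; `13` one more than the head of the open bundle (zero if none is
open); `14` the code of the current state; `15` the best value found; `16` the chosen core; `17`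
the cache left; the others are counters and auxiliary variables.

The arrays `0, 1, 2` hold the input; `3, 4` the output; `5` the powers of the base; `6` the integer
loads; `7` the jobs in the order of decreasing demand; `8` and `9` the loads and demands in this
order; `10` the head of the bundle of each position; `11` the loads of the bundles; `12` their
rounded loads; `13` the table; `14` the load levels of the cores; `15` the cores of the
positions. -/

infixr:30 " ;; " => LProg.seq

/-- The precision and the base. -/
def precision : LProg :=
  assign 5 ((var 4 / var 3 + const 1) * const 13) ;;
  assign 7 (var 1 + const 1)

/-- The number of levels and the number of candidate makespans. -/
def limits : LProg :=
  assign 6 (var 5 * var 5 + var 5 * const 3 + const 4) ;;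
  assign 9 (var 0 * var 5 + const 1)

/-- The powers of the base. -/
def powers : LProg :=
  assign 8 (const 1) ;;
  .upto 18 6 (
    write 5 (var 18) (var 8) ;;
    assign 8 (var 8 * var 7))

/-- The common denominator, the integer loads and the largest load. -/
def loads : LProg :=
  assign 10 (const 1) ;;
  .upto 18 0 (assign 10 (var 10 * read 1 (var 18))) ;;
  assign 11 (const 1) ;;
  .upto 18 0 (
    assign 24 (var 10 / read 1 (var 18) * read 0 (var 18)) ;;
    ite (var 24 - var 11) (assign 11 (var 24)) skip ;;
    write 6 (var 18) (var 24 * var 5))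

/-- Ordering the jobs by decreasing demand. -/
def order : LProg :=
  .upto 18 0 (
    assign 21 (const 0) ;;
    .upto 19 0 (
      ite ((read 2 (var 19) * var 0 + var 19) - (read 2 (var 18) * var 0 + var 18))
        (assign 21 (var 21 + const 1)) skip) ;;
    write 7 (var 21) (var 18) ;;
    write 8 (var 21) (read 6 (var 18)) ;;
    write 9 (var 21) (read 2 (var 18)))

/-- Bundling the small jobs. -/
def bundle : LProg :=
  assign 13 (const 0) ;;
  .upto 18 0 (
    ite (read 8 (var 18) * var 5 - var 12)
      (write 10 (var 18) (var 18) ;; write 11 (var 18) (read 8 (var 18)))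
      (write 11 (var 18) (const 0) ;;
        ite (var 13) skip (assign 13 (var 18 + const 1)) ;;
        write 10 (var 18) (var 13 - const 1) ;;
        write 11 (var 13 - const 1) (read 11 (var 13 - const 1) + read 8 (var 18)) ;;
        ite (read 11 (var 13 - const 1) * var 5 - var 12) (assign 13 (const 0)) skip))

/-- Rounding the loads of the bundles. -/
def round : LProg :=
  .upto 18 0 (
    ite (var 18 - read 10 (var 18)) (write 12 (var 18) (const 0))
      (write 12 (var 18) (read 11 (var 18) * var 5 * var 5 / var 12 + const 1)))

/-- The minimum in one entry of the table. -/
def entry : LProg :=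
  assign 15 (var 2 + const 1) ;;
  .upto 19 6 (
    assign 24 (var 19 + read 12 (var 22)) ;;
    ite (var 6 - var 24) (
      ite (var 25 / read 5 (var 19) - var 25 / read 5 (var 19) / var 7 * var 7) (
        assign 26 (read 13 (var 23 + var 8 + (var 25 - read 5 (var 19) + read 5 (var 24)))) ;;
        ite (var 19) skip (assign 26 (var 26 + read 9 (var 22))) ;;
        ite (var 15 - var 26) (assign 15 (var 26)) skip) skip) skip) ;;
  write 13 (var 23 + var 25) (var 15)

/-- The table of the costs to go. -/
def table : LProg :=
  .upto 18 0 (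
    assign 22 (var 0 - const 1 - var 18) ;;
    assign 23 (var 22 * var 8) ;;
    .upto 25 8 entry)

/-- The choice of a core for the bundle at the position `18`. -/
def choose : LProg :=
  .upto 19 1 (
    assign 24 (read 14 (var 19) + read 12 (var 18)) ;;
    ite (var 6 - var 24) (
      assign 26 (read 13 (var 23 + var 8 +
        (var 14 - read 5 (read 14 (var 19)) + read 5 (var 24)))) ;;
      ite (read 14 (var 19)) skip (assign 26 (var 26 + read 9 (var 18))) ;;
      ite (read 13 (var 23 + var 14) + const 1 - var 26) (assign 16 (var 19)) skip) skip)

/-- Placing the bundle at the position `18` on the chosen core. -/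
def place : LProg :=
  write 15 (var 18) (var 16) ;;
  ite (read 14 (var 16)) skip (
    write 3 (var 16) (read 3 (var 16) + read 9 (var 18)) ;;
    assign 17 (var 17 - read 9 (var 18))) ;;
  assign 24 (read 14 (var 16) + read 12 (var 18)) ;;
  assign 14 (var 14 - read 5 (read 14 (var 16)) + read 5 (var 24)) ;;
  write 14 (var 16) (var 24) ;;
  write 4 (read 7 (var 18)) (read 15 (read 10 (var 18)))

/-- Reading a solution off the table. -/
def construct : LProg :=
  assign 17 (var 2) ;;
  assign 14 (var 1) ;;
  .upto 19 1 (write 14 (var 19) (const 0) ;; write 3 (var 19) (const 0)) ;;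
  .upto 18 0 (
    assign 23 (var 18 * var 8) ;;
    choose ;;
    place) ;;
  write 3 (const 0) (read 3 (const 0) + var 17)

/-- Testing one candidate makespan. -/
def attempt : LProg :=
  bundle ;; round ;; table ;;
  ite (var 2 + const 1 - read 13 (var 1)) construct skip

/-- Testing all candidate makespans, in decreasing order. -/
def search : LProg :=
  loads ;; order ;;
  assign 12 (var 11 * var 9) ;;
  .upto 20 9 (attempt ;; assign 12 (var 12 - var 11))

theorem precision_ok : precision.ok [0, 1, 2, 3, 4] [] [] = true := by decide
theorem limits_ok : limits.ok [0, 1, 2, 3, 4, 5, 7] [] [] = true := by decide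
theorem powers_ok : powers.ok [0, 1, 2, 3, 4, 5, 6, 7, 9] [] [6] = true := by decide
theorem search_ok :
    search.ok [0, 1, 2, 5, 6, 7, 8, 9] [0, 1, 2, 5] [0, 1, 6, 8, 9] = true := by decide

/-! ### Codes of states -/

/-- The code of the assignment of load levels to the cores. -/
def enc (B : ℕ) {c : ℕ} (lev : Fin c → ℕ) : ℕ := ∑ t, B ^ lev t

theorem enc_zero (B c : ℕ) : enc B (fun _ : Fin c => 0) = c := by simp [enc]

theorem enc_update (B : ℕ) {c : ℕ} (lev : Fin c → ℕ) (t : Fin c) (m : ℕ) :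
    enc B (Function.update lev t m) = enc B lev - B ^ lev t + B ^ m := by
  unfold enc
  rw [← Finset.add_sum_erase _ _ (Finset.mem_univ t),
    ← Finset.add_sum_erase _ (fun t => B ^ lev t) (Finset.mem_univ t)]
  have : ∑ x ∈ Finset.univ.erase t, B ^ Function.update lev t m x =
      ∑ x ∈ Finset.univ.erase t, B ^ lev x :=
    Finset.sum_congr rfl fun x hx => by rw [Function.update_of_ne (Finset.ne_of_mem_erase hx)]
  rw [this]
  simp only [Function.update_self]
  omega

theorem sum_pow_lt {B c l : ℕ} (hB : c < B) (s : Finset (Fin c)) (lev : Fin c → ℕ)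
    (h : ∀ t ∈ s, lev t < l) : ∑ t ∈ s, B ^ lev t < B ^ l := by
  rcases l with _ | l
  · have : s = ∅ := Finset.eq_empty_of_forall_notMem fun t ht => by simpa using h t ht
    simp [this]
  · calc ∑ t ∈ s, B ^ lev t ≤ ∑ _t ∈ s, B ^ l :=
          Finset.sum_le_sum fun t ht => Nat.pow_le_pow_right (by omega) (by have := h t ht; omega)
      _ = s.card * B ^ l := by simp
      _ ≤ c * B ^ l := by gcongr; simpa using Finset.card_le_univ s
      _ < B ^ (l + 1) := by rw [pow_succ']; exact Nat.mul_lt_mul_of_pos_right hB (Nat.pow_pos (by omega))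

theorem enc_lt {B c l : ℕ} (hB : c < B) (lev : Fin c → ℕ) (h : ∀ t, lev t < l) :
    enc B lev < B ^ l :=
  sum_pow_lt hB _ lev fun t _ => h t

theorem enc_digit {B c : ℕ} (hB : c < B) (lev : Fin c → ℕ) (l : ℕ) :
    enc B lev / B ^ l - enc B lev / B ^ l / B * B = (Finset.univ.filter fun t => lev t = l).card := by
  set k := (Finset.univ.filter fun t => lev t = l).card with hk
  have hsplit : enc B lev = ∑ t with lev t < l, B ^ lev t +
      B ^ l * (k + B * ∑ t with l < lev t, B ^ (lev t - l - 1)) := by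
    have h1 : enc B lev = ∑ t with lev t < l, B ^ lev t + ∑ t with ¬ lev t < l, B ^ lev t :=
      (Finset.sum_filter_add_sum_filter_not _ _ _).symm
    have h2 : ∑ t with ¬ lev t < l, B ^ lev t =
        ∑ t with lev t = l, B ^ lev t + ∑ t with l < lev t, B ^ lev t := by
      simp only [Finset.sum_filter]
      rw [← Finset.sum_add_distrib]
      refine Finset.sum_congr rfl fun t _ => ?_
      split_ifs <;> omega
    have h3 : ∑ t with lev t = l, B ^ lev t = B ^ l * k := by
      rw [Finset.sum_congr rfl fun t ht => by rw [(Finset.mem_filter.1 ht).2]]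
      simp [hk, mul_comm]
    have h4 : ∑ t with l < lev t, B ^ lev t =
        B ^ l * (B * ∑ t with l < lev t, B ^ (lev t - l - 1)) := by
      rw [Finset.mul_sum, Finset.mul_sum]
      refine Finset.sum_congr rfl fun t ht => ?_
      have := (Finset.mem_filter.1 ht).2
      rw [← pow_succ', ← pow_add]
      congr 1; omega
    rw [h1, h2, h3, h4, mul_add]
  have hlow : ∑ t with lev t < l, B ^ lev t < B ^ l :=
    sum_pow_lt hB _ lev fun t ht => (Finset.mem_filter.1 ht).2
  have hpos : 0 < B ^ l := Nat.pow_pos (by omega)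
  have hkB : k < B := (Finset.card_le_univ _).trans_lt (by simpa using hB)
  have hd : enc B lev / B ^ l = k + B * ∑ t with l < lev t, B ^ (lev t - l - 1) := by
    rw [hsplit, Nat.add_mul_div_left _ _ hpos, Nat.div_eq_of_lt hlow, zero_add]
  rw [hd, Nat.add_mul_div_left _ _ (by omega), Nat.div_eq_of_lt hkB, zero_add, mul_comm]
  omega

/-! ### The table -/

/-- The cost of placing the bundle `i` on the core `t` and of all later bundles, according to the
table `V`. -/
def stepCost (B W : ℕ) (r x V : ℕ → ℕ) (i : ℕ) {c : ℕ} (lev : Fin c → ℕ) (t : Fin c) : ℕ :=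
  V ((i + 1) * W + enc B (Function.update lev t (lev t + r i))) + if lev t = 0 then x i else 0

/-- The entry of the table `V` for the bundle `i` and the load levels `lev` is the minimum cost of
a step, if this is at most `K`. -/
structure IsEntry (B L W K : ℕ) (r x V : ℕ → ℕ) (i : ℕ) {c : ℕ} (lev : Fin c → ℕ) : Prop where
  le : ∀ t, lev t + r i < L → V (i * W + enc B lev) ≤ stepCost B W r x V i lev t
  exists_le : V (i * W + enc B lev) ≤ K →
    ∃ t, lev t + r i < L ∧ stepCost B W r x V i lev t ≤ V (i * W + enc B lev)

/-- The load of the core `t` after placing the first `i` bundles according to `g`. -/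
def levels {c : ℕ} (r : ℕ → ℕ) (g : ℕ → Fin c) (i : ℕ) (t : Fin c) : ℕ :=
  ∑ k ∈ (Finset.range i).filter (fun k => g k = t), r k

theorem levels_succ {c : ℕ} (r : ℕ → ℕ) (g : ℕ → Fin c) (i : ℕ) :
    levels r g (i + 1) = Function.update (levels r g i) (g i) (levels r g i (g i) + r i) := by
  funext t
  simp only [levels, Finset.sum_filter, Finset.sum_range_succ, Function.update_apply]
  split_ifs with h1 h2 h2
  · rw [h1]
  · exact absurd h1.symm h2
  · exact absurd h2.symm h1
  · rfl

theorem levels_mono {c : ℕ} (r : ℕ → ℕ) (g : ℕ → Fin c) {i j : ℕ} (h : i ≤ j) (t : Fin c) :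
    levels r g i t ≤ levels r g j t :=
  Finset.sum_le_sum_of_subset (Finset.filter_subset_filter _ (Finset.range_mono h))

/-- The table bounds the cost of every placement from below. -/
theorem table_le {B L W K n c : ℕ} {r x V : ℕ → ℕ}
    (hV : ∀ i < n, ∀ lev : Fin c → ℕ, (∀ t, lev t < L) → IsEntry B L W K r x V i lev)
    (hn : ∀ lev : Fin c → ℕ, (∀ t, lev t < L) → V (n * W + enc B lev) = 0)
    (g : ℕ → Fin c) (p : Fin c → ℕ) (hL : ∀ t, levels r g n t < L)
    (hg : ∀ i < n, levels r g i (g i) = 0 → 0 < r i ∧ x i ≤ p (g i)) :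
    V c ≤ ∑ t, p t := by
  have key : ∀ d ≤ n, V ((n - d) * W + enc B (levels r g (n - d))) ≤
      ∑ t with levels r g (n - d) t = 0, p t := by
    intro d
    induction d with
    | zero => intro _; rw [Nat.sub_zero, hn _ hL]; exact Nat.zero_le _
    | succ d ih =>
      intro hd
      obtain ⟨i, hi⟩ : ∃ i, i = n - (d + 1) := ⟨_, rfl⟩
      have hi' : n - d = i + 1 := by omega
      have ih := ih (by omega)
      rw [← hi]
      rw [hi'] at ih
      have hin : i < n := by omega
      have hs := levels_succ r g i
      have h1 := (hV i hin (levels r g i) fun t =>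
        (levels_mono r g hin.le t).trans_lt (hL t)).le (g i) (by
          have := hL (g i)
          have h2 := levels_mono r g (show i + 1 ≤ n by omega) (g i)
          rw [hs, Function.update_self] at h2
          omega)
      rw [stepCost, ← hs] at h1
      refine h1.trans ((Nat.add_le_add_right ih _).trans ?_)
      split_ifs with h0
      · obtain ⟨hr, hx⟩ := hg i hin h0
        rw [← Finset.add_sum_erase (Finset.univ.filter fun t => levels r g i t = 0) p
          (a := g i) (by simpa using h0), add_comm (p _)]
        refine Nat.add_le_add (Finset.sum_le_sum_of_subset fun t ht => ?_) hx
        simp only [Finset.mem_filter, Finset.mem_univ, true_and, Finset.mem_erase] at ht ⊢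
        rw [hs] at ht
        by_cases htg : t = g i
        · subst htg; simp at ht; omega
        · rw [Function.update_of_ne htg] at ht; exact ⟨htg, ht⟩
      · rw [add_zero]
        refine Finset.sum_le_sum_of_subset fun t ht => ?_
        simp only [Finset.mem_filter, Finset.mem_univ, true_and] at ht ⊢
        have := levels_mono r g (show i ≤ i + 1 by omega) t
        omega
  have h := key n le_rfl
  have h0 : levels r g 0 = fun _ => 0 := by funext t; simp [levels]
  rw [Nat.sub_self, h0, enc_zero, zero_mul, zero_add] at h
  simpa using h

/-! ### Bundles -/

/-- The first `n` positions are grouped into bundles, `lead i` being the head of the bundle of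
`i`. A job of load `a i` with `T < a i * q` is a bundle of its own. The array `w` holds the loads
of the bundles, and `o` is one more than the head of the open bundle (zero if none is open). -/
structure IsBundling (q T : ℕ) (a : ℕ → ℕ) (n : ℕ) (lead w : ℕ → ℕ) (o : ℕ) : Prop where
  lead_le : ∀ i < n, lead i ≤ i
  lead_lead : ∀ i < n, lead (lead i) = lead i
  lead_big : ∀ i < n, T < a i * q → lead i = i
  lead_small : ∀ i < n, a i * q ≤ T → a (lead i) * q ≤ T
  mono : ∀ i j, i ≤ j → j < n → a i * q ≤ T → a j * q ≤ T → lead i ≤ lead j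
  weight : ∀ l < n, w l = ∑ i ∈ (Finset.range n).filter (fun i => lead i = l), a i
  weight_small : ∀ l < n, a l * q ≤ T → w l * q ≤ 2 * T
  full : ∀ l < n, lead l = l → T < w l * q ∨ o = l + 1
  open_lead : ∀ l, o = l + 1 → l < n ∧ lead l = l ∧ a l * q ≤ T ∧ w l * q ≤ T ∧
    ∀ i < n, a i * q ≤ T → lead i ≤ l

theorem isBundling_zero (q T : ℕ) (a lead w : ℕ → ℕ) : IsBundling q T a 0 lead w 0 := by
  constructor <;> simp

/-- Appending a big job. -/
theorem IsBundling.big {q T n o : ℕ} {a lead w : ℕ → ℕ} (h : IsBundling q T a n lead w o)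
    (hn : T < a n * q) :
    IsBundling q T a (n + 1) (Function.update lead n n) (Function.update w n (a n)) o := by
  have hl : ∀ i < n, Function.update lead n n i = lead i := fun i hi =>
    Function.update_of_ne hi.ne _ _
  have hw : ∀ i < n, Function.update w n (a n) i = w i := fun i hi =>
    Function.update_of_ne hi.ne _ _
  have cases : ∀ i, i < n + 1 → i < n ∨ i = n := fun i hi => by omega
  constructor
  · intro i hi
    rcases cases i hi with h1 | rfl
    · rw [hl i h1]; exact h.lead_le i h1
    · simp
  · intro i hi
    rcases cases i hi with h1 | rfl
    · rw [hl i h1, hl _ ((h.lead_le i h1).trans_lt h1)]; exact h.lead_lead i h1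
    · simp
  · intro i hi hb
    rcases cases i hi with h1 | rfl
    · rw [hl i h1]; exact h.lead_big i h1 hb
    · simp
  · intro i hi hb
    rcases cases i hi with h1 | rfl
    · rw [hl i h1]; exact h.lead_small i h1 hb
    · omega
  · intro i j hij hj hi' hj'
    rcases cases j hj with h1 | rfl
    · rw [hl i (by omega), hl j h1]; exact h.mono i j hij h1 hi' hj'
    · omega
  · intro l hl'
    rcases cases l hl' with h1 | rfl
    · rw [hw l h1, h.weight l h1]
      simp only [Finset.sum_filter, Finset.sum_range_succ, Function.update_self]
      rw [if_neg (by omega), add_zero]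
      exact Finset.sum_congr rfl fun i hi => by rw [hl i (Finset.mem_range.1 hi)]
    · simp only [Finset.sum_filter, Finset.sum_range_succ, Function.update_self, if_true]
      rw [Finset.sum_eq_zero, zero_add]
      intro i hi
      have hi := Finset.mem_range.1 hi
      have := h.lead_le i hi
      rw [hl i hi, if_neg (by omega)]
  · intro l hl' hs
    rcases cases l hl' with h1 | rfl
    · rw [hw l h1]; exact h.weight_small l h1 hs
    · omega
  · intro l hl' he
    rcases cases l hl' with h1 | rfl
    · rw [hw l h1]; exact h.full l h1 (by rwa [hl l h1] at he)
    · simp [hn]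
  · intro l ho
    obtain ⟨h1, h2, h3, h4, h5⟩ := h.open_lead l ho
    rw [hl l h1, hw l h1]
    refine ⟨by omega, h2, h3, h4, fun i hi hs => ?_⟩
    rcases cases i hi with h6 | rfl
    · rw [hl i h6]; exact h5 i h6 hs
    · omega

/-- Appending a small job to the bundle with head `l`, which is the open bundle or a new one. -/
theorem IsBundling.small {q T n o l o' v : ℕ} {a lead w lead' w' : ℕ → ℕ}
    (h : IsBundling q T a n lead w o) (hn : a n * q ≤ T)
    (hl : o = l + 1 ∨ o = 0 ∧ l = n) (hlead : lead' = Function.update lead n l)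
    (hv : v = Function.update w n 0 l + a n)
    (hw : w' = Function.update (Function.update w n 0) l v)
    (ho : o' = if T < v * q then 0 else l + 1) :
    IsBundling q T a (n + 1) lead' w' o' := by
  have cases : ∀ i, i < n + 1 → i < n ∨ i = n := fun i hi => by omega
  have hl' : ∀ i < n, lead' i = lead i := fun i hi => by
    rw [hlead]; exact Function.update_of_ne hi.ne _ _
  have hln : lead' n = l := by rw [hlead]; simp
  have hle : l ≤ n := by
    rcases hl with h1 | h1
    · exact (h.open_lead l h1).1.le
    · omega
  have hll : lead' l = l := by
    rcases hl with h1 | ⟨-, rfl⟩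
    · have := h.open_lead l h1
      rw [hl' l this.1]; exact this.2.1
    · exact hln
  have hls : a l * q ≤ T := by
    rcases hl with h1 | ⟨-, rfl⟩
    · exact (h.open_lead l h1).2.2.1
    · exact hn
  have hvl : w' l = v := by rw [hw]; simp
  have hwi : ∀ i < n, i ≠ l → w' i = w i := fun i hi hil => by
    rw [hw, Function.update_of_ne hil, Function.update_of_ne hi.ne]
  have hwn : n ≠ l → w' n = 0 := fun hil => by
    rw [hw, Function.update_of_ne hil, Function.update_self]
  have hleadl : ∀ i < n, a i * q ≤ T → lead i ≤ l := fun i hi hs => by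
    rcases hl with h1 | ⟨-, rfl⟩
    · exact (h.open_lead l h1).2.2.2.2 i hi hs
    · exact (h.lead_le i hi).trans hi.le
  have hvq : v * q ≤ 2 * T := by
    rw [hv]
    rcases hl with h1 | ⟨-, rfl⟩
    · have := h.open_lead l h1
      rw [Function.update_of_ne this.1.ne]
      have := this.2.2.2.1
      nlinarith
    · rw [Function.update_self, zero_add]; omega
  have hsum : ∀ k, ∑ i ∈ (Finset.range (n + 1)).filter (fun i => lead' i = k), a i =
      ∑ i ∈ (Finset.range n).filter (fun i => lead i = k), a i + if l = k then a n else 0 := by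
    intro k
    simp only [Finset.sum_filter, Finset.sum_range_succ, hln]
    congr 1
    exact Finset.sum_congr rfl fun i hi => by rw [hl' i (Finset.mem_range.1 hi)]
  have hsn : ∑ i ∈ (Finset.range n).filter (fun i => lead i = n), a i = 0 := by
    rw [Finset.sum_filter]
    refine Finset.sum_eq_zero fun i hi => ?_
    have hi := Finset.mem_range.1 hi
    have := h.lead_le i hi
    rw [if_neg (by omega)]
  constructor
  · intro i hi
    rcases cases i hi with h1 | rfl
    · rw [hl' i h1]; exact h.lead_le i h1
    · rw [hln]; exact hle
  · intro i hi
    rcases cases i hi with h1 | rfl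
    · rw [hl' i h1, hl' _ ((h.lead_le i h1).trans_lt h1)]; exact h.lead_lead i h1
    · rw [hln, hll]
  · intro i hi hb
    rcases cases i hi with h1 | rfl
    · rw [hl' i h1]; exact h.lead_big i h1 hb
    · omega
  · intro i hi hb
    rcases cases i hi with h1 | rfl
    · rw [hl' i h1]; exact h.lead_small i h1 hb
    · rw [hln]; exact hls
  · intro i j hij hj hi' hj'
    rcases cases j hj with h1 | rfl
    · rw [hl' i (by omega), hl' j h1]; exact h.mono i j hij h1 hi' hj'
    · rw [hln]
      rcases hij.lt_or_eq with h2 | rfl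
      · rw [hl' i h2]; exact hleadl i h2 hi'
      · exact hln.le
  · intro k hk
    rw [hsum]
    rcases cases k hk with h1 | rfl
    · by_cases hkl : k = l
      · subst hkl
        rw [hvl, hv, Function.update_of_ne h1.ne, h.weight k h1, if_pos rfl]
      · rw [hwi k h1 hkl, h.weight k h1, if_neg (Ne.symm hkl), add_zero]
    · rw [hsn, zero_add]
      by_cases hkl : k = l
      · subst hkl
        rw [hvl, hv, if_pos rfl]; simp
      · rw [hwn hkl, if_neg (Ne.symm hkl)]
  · intro k hk hs
    by_cases hkl : k = l
    · subst hkl; rw [hvl]; exact hvq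
    · rcases cases k hk with h1 | rfl
      · rw [hwi k h1 hkl]; exact h.weight_small k h1 hs
      · rw [hwn hkl, zero_mul]; exact Nat.zero_le _
  · intro k hk he
    by_cases hkl : k = l
    · subst hkl; rw [hvl, ho]
      split_ifs with hT
      · exact Or.inl hT
      · exact Or.inr rfl
    · rcases cases k hk with h1 | rfl
      · rw [hwi k h1 hkl]
        rcases h.full k h1 (by rwa [hl' k h1] at he) with h2 | h2
        · exact Or.inl h2
        · exact absurd h2 (by omega)
      · exact absurd (he.symm.trans hln) hkl
  · intro k hk
    rw [hk] at ho
    split_ifs at ho with hT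
    obtain rfl : k = l := by omega
    refine ⟨by omega, hll, hls, by rw [hvl]; omega, fun i hi hs => ?_⟩
    rcases cases i hi with h1 | rfl
    · rw [hl' i h1]; exact hleadl i h1 hs
    · rw [hln]

section Bundles

variable {q T n o c : ℕ} {a x lead w : ℕ → ℕ}

/-- The rounded load of the bundle with head `i` (zero if `i` is not the head of a bundle). -/
def rounded (q T : ℕ) (lead w : ℕ → ℕ) (i : ℕ) : ℕ :=
  if lead i = i then w i * q * q / T + 1 else 0

/-- The load of the core `t` when the big jobs are placed by `s` and the bundles of small jobs
with head before `k` by `g`. -/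
def mixedLoad (q T : ℕ) (a lead w : ℕ → ℕ) (n : ℕ) (s g : ℕ → Fin c) (k : ℕ) (t : Fin c) : ℕ :=
  ∑ i ∈ (Finset.range n).filter (fun i => T < a i * q ∧ s i = t), a i +
    ∑ i ∈ (Finset.range k).filter (fun i => (lead i = i ∧ a i * q ≤ T) ∧ g i = t), w i

/-- Some core with enough cache for the bundle with head `k` has load at most `T` when the earlier
bundles are placed: these consist of jobs of demand at least `x k`, which `s` places on the same
cores. -/
theorem IsBundling.exists_core (h : IsBundling q T a n lead w o) (s g : ℕ → Fin c) (p : Fin c → ℕ)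
    (hx : ∀ i j, i ≤ j → j < n → x j ≤ x i) (hs : ∀ i < n, x i ≤ p (s i))
    (hT : ∀ t, ∑ i ∈ (Finset.range n).filter (fun i => s i = t), a i ≤ T)
    {k : ℕ} (hk : k < n) (hlk : lead k = k) (hsk : a k * q ≤ T) :
    ∃ t, x k ≤ p t ∧ mixedLoad q T a lead w n s g k t ≤ T := by
  by_contra! hcon
  set C : Finset (Fin c) := Finset.univ.filter fun t => x k ≤ p t with hC
  have hne : C.Nonempty := ⟨s k, by simpa [hC] using hs k hk⟩
  have hlt : ∑ t ∈ C, T < ∑ t ∈ C, mixedLoad q T a lead w n s g k t :=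
    Finset.sum_lt_sum_of_nonempty hne fun t ht => hcon t (by simpa [hC] using ht)
  refine absurd hlt (not_lt.2 (le_trans ?_ (Finset.sum_le_sum fun t _ => hT t)))
  have hfib : ∀ (S : Finset ℕ) (f : ℕ → Fin c) (P : ℕ → Prop) [DecidablePred P] (v : ℕ → ℕ),
      ∑ t ∈ C, ∑ i ∈ S.filter (fun i => P i ∧ f i = t), v i =
        ∑ i ∈ S.filter (fun i => P i ∧ f i ∈ C), v i := by
    intro S f P _ v
    simp only [Finset.sum_filter]
    rw [Finset.sum_comm]
    refine Finset.sum_congr rfl fun i _ => ?_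
    by_cases hP : P i <;> simp [hP]
  have hfib' := hfib (Finset.range n) s (fun _ => True) a
  simp only [true_and] at hfib'
  rw [hfib']
  simp only [mixedLoad, Finset.sum_add_distrib]
  rw [hfib, hfib]
  have hsmall : ∑ i ∈ (Finset.range k).filter (fun i => (lead i = i ∧ a i * q ≤ T) ∧ g i ∈ C), w i ≤
      ∑ i ∈ (Finset.range n).filter (fun i => a i * q ≤ T ∧ s i ∈ C), a i := by
    calc _ ≤ ∑ l ∈ (Finset.range k).filter (fun i => lead i = i ∧ a i * q ≤ T), w l :=
          Finset.sum_le_sum_of_subset fun i => by simp only [Finset.mem_filter]; tauto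
      _ = ∑ l ∈ (Finset.range k).filter (fun i => lead i = i ∧ a i * q ≤ T),
          ∑ i ∈ (Finset.range n).filter (fun i => lead i = l), a i :=
          Finset.sum_congr rfl fun l hl => h.weight l (by
            have := Finset.mem_range.1 (Finset.mem_filter.1 hl).1; omega)
      _ = ∑ i ∈ (Finset.range n).filter (fun i => lead i ∈
          (Finset.range k).filter (fun i => lead i = i ∧ a i * q ≤ T)), a i := by
          simp only [Finset.sum_filter (s := Finset.range n)]
          rw [Finset.sum_comm]
          exact Finset.sum_congr rfl fun i _ => by rw [Finset.sum_ite_eq]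
      _ ≤ _ := by
          refine Finset.sum_le_sum_of_subset fun i hi => ?_
          simp only [Finset.mem_filter, Finset.mem_range] at hi ⊢
          obtain ⟨hin, hik, -, hls⟩ := hi
          have his : a i * q ≤ T := by
            by_contra hb
            rw [h.lead_big i hin (not_le.1 hb)] at hls
            exact hb hls
          have hik' : i < k := by
            by_contra hki
            have := h.mono k i (not_lt.1 hki) hin hsk his
            omega
          refine ⟨hin, his, ?_⟩
          simp only [hC, Finset.mem_filter, Finset.mem_univ, true_and]
          exact (hx i k hik'.le hk).trans (hs i hin)
  refine (Nat.add_le_add_left hsmall _).trans (le_of_eq ?_)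
  simp only [Finset.sum_filter]
  rw [← Finset.sum_add_distrib]
  refine Finset.sum_congr rfl fun i _ => ?_
  by_cases h1 : s i ∈ C <;> by_cases h2 : T < a i * q <;> simp [h1, h2, not_lt.1, not_le.2]

/-- The bundles can be placed like the jobs, with loads that are a little larger. -/
theorem IsBundling.exists_mixedLoad_le (h : IsBundling q T a n lead w o) (s : ℕ → Fin c)
    (p : Fin c → ℕ) (hx : ∀ i j, i ≤ j → j < n → x j ≤ x i) (hs : ∀ i < n, x i ≤ p (s i))
    (hT : ∀ t, ∑ i ∈ (Finset.range n).filter (fun i => s i = t), a i ≤ T) :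
    ∀ k ≤ n, ∃ g : ℕ → Fin c, (∀ i < k, lead i = i → a i * q ≤ T → x i ≤ p (g i)) ∧
      ∀ t, mixedLoad q T a lead w n s g k t * q ≤ (q + 2) * T := by
  intro k
  induction k with
  | zero =>
    refine fun _ => ⟨s, by simp, fun t => ?_⟩
    have : ∑ i ∈ (Finset.range n).filter (fun i => T < a i * q ∧ s i = t), a i ≤ T :=
      (Finset.sum_le_sum_of_subset fun i => by simp only [Finset.mem_filter]; tauto).trans (hT t)
    simp only [mixedLoad, Finset.range_zero, Finset.filter_empty, Finset.sum_empty, add_zero]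
    nlinarith
  | succ k ih =>
    intro hk
    obtain ⟨g, hg1, hg2⟩ := ih (by omega)
    by_cases hc : lead k = k ∧ a k * q ≤ T
    · obtain ⟨t₀, ht₀, hl₀⟩ := h.exists_core s g p hx hs hT (show k < n by omega) hc.1 hc.2
      refine ⟨Function.update g k t₀, fun i hi h1 h2 => ?_, fun t => ?_⟩
      · by_cases hik : i = k
        · subst hik; simpa using ht₀
        · rw [Function.update_of_ne hik]; exact hg1 i (by omega) h1 h2
      · have e : mixedLoad q T a lead w n s (Function.update g k t₀) (k + 1) t =
            mixedLoad q T a lead w n s g k t + if t₀ = t then w k else 0 := by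
          simp only [mixedLoad, Finset.sum_filter (s := Finset.range (k + 1)),
            Finset.sum_range_succ, Function.update_self, add_assoc]
          congr 2
          · rw [Finset.sum_filter]
            refine Finset.sum_congr rfl fun i hi => ?_
            rw [Function.update_of_ne (Finset.mem_range.1 hi).ne]
          · simp [hc]
        rw [e]
        split_ifs with ht
        · subst ht
          have := h.weight_small k (by omega) hc.2
          nlinarith
        · exact hg2 t
    · refine ⟨g, fun i hi h1 h2 => ?_, fun t => ?_⟩
      · by_cases hik : i = k
        · subst hik; exact absurd ⟨h1, h2⟩ hc
        · exact hg1 i (by omega) h1 h2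
      · refine le_trans (le_of_eq ?_) (hg2 t)
        simp only [mixedLoad, Finset.sum_filter (s := Finset.range (k + 1)),
          Finset.sum_range_succ]
        rw [Finset.sum_filter (s := Finset.range k), if_neg (by tauto), add_zero]

/-- The bundles can be placed such that the rounded loads are bounded, and every core is opened
by the head of a bundle whose demand is met. -/
theorem IsBundling.exists_placement (h : IsBundling q T a n lead w o) (hT0 : 0 < T)
    (s : ℕ → Fin c) (p : Fin c → ℕ) (hx : ∀ i j, i ≤ j → j < n → x j ≤ x i)
    (hs : ∀ i < n, x i ≤ p (s i))
    (hT : ∀ t, ∑ i ∈ (Finset.range n).filter (fun i => s i = t), a i ≤ T) :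
    ∃ g : ℕ → Fin c, (∀ t, levels (rounded q T lead w) g n t < q * q + q * 3 + 4) ∧
      ∀ i < n, levels (rounded q T lead w) g i (g i) = 0 →
        0 < rounded q T lead w i ∧ x i ≤ p (g i) := by
  obtain ⟨g, hg1, hg2⟩ := h.exists_mixedLoad_le s p hx hs hT n le_rfl
  set g' : ℕ → Fin c := fun i => if T < a (lead i) * q then s (lead i) else g (lead i) with hg'
  have hlead : ∀ i < n, lead i = i → x i ≤ p (g' i) := by
    intro i hi hl
    simp only [hg', hl]
    split_ifs with hb
    · exact hs i hi
    · exact hg1 i hi hl (not_lt.1 hb)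
  refine ⟨g', fun t => ?_, fun i hi h0 => ?_⟩
  · have hW : ∑ i ∈ (Finset.range n).filter (fun i => lead i = i ∧ g' i = t), w i =
        mixedLoad q T a lead w n s g n t := by
      simp only [mixedLoad, Finset.sum_filter]
      rw [← Finset.sum_add_distrib]
      refine Finset.sum_congr rfl fun i hi => ?_
      have hi := Finset.mem_range.1 hi
      by_cases hb : T < a i * q
      · have hl := h.lead_big i hi hb
        have hw : w i = a i := by
          rw [h.weight i hi]
          refine Finset.sum_eq_single_of_mem i (by simp [hi, hl]) fun j hj hji => ?_
          simp only [Finset.mem_filter, Finset.mem_range] at hj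
          exfalso
          by_cases hbj : T < a j * q
          · exact hji ((h.lead_big j hj.1 hbj).symm.trans hj.2)
          · have := h.lead_small j hj.1 (not_lt.1 hbj)
            rw [hj.2] at this; omega
        simp [hg', hl, hb, hw, not_le.2 hb]
      · by_cases hl : lead i = i
        · simp [hg', hl, hb, not_lt.1 hb]
        · simp [hl, hb]
    have hlev : levels (rounded q T lead w) g' n t =
        ∑ i ∈ (Finset.range n).filter (fun i => lead i = i ∧ g' i = t), (w i * q * q / T + 1) := by
      simp only [levels, Finset.sum_filter, rounded]
      refine Finset.sum_congr rfl fun i _ => ?_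
      by_cases h1 : lead i = i <;> simp [h1]
    rw [hlev]
    set S := (Finset.range n).filter (fun i => lead i = i ∧ g' i = t) with hS
    have hterm : ∀ i ∈ S, (w i * q * q / T + 1) * T ≤
        w i * (q * q + q) + if o = i + 1 then T else 0 := by
      intro i hi
      simp only [hS, Finset.mem_filter, Finset.mem_range] at hi
      have h1 := Nat.div_mul_le_self (w i * q * q) T
      rcases h.full i hi.1 hi.2.1 with h2 | h2
      · exact le_trans (by nlinarith) (Nat.le_add_right _ _)
      · rw [if_pos h2]; nlinarith [Nat.zero_le (w i * q)]
    have hone : ∑ i ∈ S, (if o = i + 1 then T else 0) ≤ T := by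
      rcases o with _ | o
      · simp
      · simp only [add_left_inj]
        rw [Finset.sum_ite_eq]; split_ifs <;> omega
    have hsum : (∑ i ∈ S, (w i * q * q / T + 1)) * T ≤ (q * q + q * 3 + 3) * T := by
      rw [Finset.sum_mul]
      refine (Finset.sum_le_sum hterm).trans ?_
      rw [Finset.sum_add_distrib, ← Finset.sum_mul, hW]
      have := hg2 t
      nlinarith
    have := Nat.le_of_mul_le_mul_right hsum hT0
    omega
  · by_cases hl : lead i = i
    · exact ⟨by simp [rounded, hl], hlead i hi hl⟩
    · exfalso
      have hli : lead i < i := lt_of_le_of_ne (h.lead_le i hi) hl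
      have hll := h.lead_lead i hi
      have hgl : g' (lead i) = g' i := by simp [hg', hll]
      have h1 : rounded q T lead w (lead i) ≤ levels (rounded q T lead w) g' i (g' i) :=
        Finset.single_le_sum (f := rounded q T lead w) (fun _ _ => Nat.zero_le _)
          (by simp [hli, hgl])
      rw [h0] at h1
      simp [rounded, hll] at h1

end Bundles

/-! ### Verification of the preparatory programs -/

theorem precision_var_five (σ : Store) :
    (precision.eval σ).var 5 = (σ.var 4 / σ.var 3 + 1) * 13 := by simp [precision]

theorem precision_var_seven (σ : Store) : (precision.eval σ).var 7 = σ.var 1 + 1 := by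
  simp [precision]

theorem limits_var_six (σ : Store) :
    (limits.eval σ).var 6 = σ.var 5 * σ.var 5 + σ.var 5 * 3 + 4 := by simp [limits]

theorem limits_var_nine (σ : Store) : (limits.eval σ).var 9 = σ.var 0 * σ.var 5 + 1 := by
  simp [limits]

theorem powers_spec (σ : Store) :
    (powers.eval σ).var 8 = σ.var 7 ^ σ.var 6 ∧
      (∀ l < σ.var 6, (powers.eval σ).arr 5 l = σ.var 7 ^ l) ∧
      ∀ l, σ.var 6 ≤ l → (powers.eval σ).arr 5 l = σ.arr 5 l := by
  simp only [powers, eval_seq]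
  refine eval_upto (x := 18) (y := 6)
    (fun i τ => τ.var 8 = σ.var 7 ^ i ∧ (∀ l < i, τ.arr 5 l = σ.var 7 ^ l) ∧
      ∀ l, i ≤ l → τ.arr 5 l = σ.arr 5 l) (by simp) ?_
  rintro i - τ hi hv - ⟨h1, h2, h3⟩
  have h7 : τ.var 7 = σ.var 7 := by simpa using hv 7 (by decide)
  refine ⟨by simp [h1, h7, pow_succ], fun l hl => ?_, fun l hl => ?_⟩
  · by_cases hli : l = i
    · subst hli; simp [hi, h1]
    · simp [hi, Function.update_of_ne hli, h2 l (by omega)]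
  · simp [hi, Function.update_of_ne (show l ≠ i by omega), h3 l (by omega)]

/-- The common denominator. -/
def denom (σ : Store) : ℕ := ∏ j ∈ Finset.range (σ.var 0), σ.arr 1 j

/-- The loads after multiplication with the common denominator. -/
def intLoad (σ : Store) (j : ℕ) : ℕ := denom σ / σ.arr 1 j * σ.arr 0 j

theorem loads_spec (σ : Store) :
    (∀ j < σ.var 0, (loads.eval σ).arr 6 j = intLoad σ j * σ.var 5) ∧
      1 ≤ (loads.eval σ).var 11 ∧ (∀ j < σ.var 0, intLoad σ j ≤ (loads.eval σ).var 11) ∧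
      ((loads.eval σ).var 11 = 1 ∨ ∃ j < σ.var 0, (loads.eval σ).var 11 = intLoad σ j) := by
  simp only [loads, eval_seq]
  have hD : ∀ σ₁ : Store, σ₁.arr = σ.arr → σ₁.var 0 = σ.var 0 → σ₁.var 10 = 1 →
      ((LProg.upto 18 0 (assign 10 (var 10 * read 1 (var 18)))).eval σ₁).var 10 = denom σ := by
    intro σ₁ ha h0 h10
    rw [denom, ← h0]
    refine eval_upto (x := 18) (y := 0)
      (fun i τ => τ.var 10 = ∏ j ∈ Finset.range i, σ.arr 1 j) (by simp [h10]) ?_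
    rintro i - τ hi - hτ h
    have h1 : τ.arr 1 = σ.arr 1 := by rw [hτ 1 (by decide), ha]
    simp [Finset.prod_range_succ, h, h1, hi]
  have hD := hD (σ.setVar 10 1) rfl (by simp) (by simp)
  set σ₁ := (LProg.upto 18 0 (assign 10 (var 10 * read 1 (var 18)))).eval (σ.setVar 10 1) with hσ₁
  have hv : ∀ z, z ∉ [18, 10] → σ₁.var z = σ.var z := fun z hz => by
    rw [hσ₁, eval_var_of_notMem _ _ _ (by simpa [modVar] using hz)]
    simp at hz; simp [hz]
  have ha : σ₁.arr = σ.arr := by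
    funext a; rw [hσ₁, eval_arr_of_notMem _ _ _ (by simp [modArr])]; rfl
  rw [← show σ₁.var 0 = σ.var 0 from hv 0 (by decide)]
  have key := eval_upto (x := 18) (y := 0) (σ := σ₁.setVar 11 1)
    (P := assign 24 (var 10 / read 1 (var 18) * read 0 (var 18)) ;;
      ite (var 24 - var 11) (assign 11 (var 24)) skip ;;
      write 6 (var 18) (var 24 * var 5))
    (fun i τ => (∀ j < i, τ.arr 6 j = intLoad σ j * σ.var 5) ∧
      1 ≤ τ.var 11 ∧ (∀ j < i, intLoad σ j ≤ τ.var 11) ∧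
      (τ.var 11 = 1 ∨ ∃ j < i, τ.var 11 = intLoad σ j)) (by simp) (by
    rintro i - τ hi hτ hτa ⟨h1, h2, h3, h4⟩
    have h5 : τ.var 5 = σ.var 5 := by rw [hτ 5 (by decide)]; simpa using hv 5 (by decide)
    have h10 : τ.var 10 = denom σ := by rw [hτ 10 (by decide)]; simpa using hD
    have ha0 : τ.arr 0 = σ.arr 0 := by rw [hτa 0 (by decide), Store.setVar_arr, ha]
    have ha1 : τ.arr 1 = σ.arr 1 := by rw [hτa 1 (by decide), Store.setVar_arr, ha]
    have hA : denom σ / σ.arr 1 i * σ.arr 0 i = intLoad σ i := rfl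
    have hcase : ∀ j < i + 1, j < i ∨ j = i := fun j hj => by omega
    have harr : ∀ j < i + 1, Function.update (τ.arr 6) i (intLoad σ i * σ.var 5) j =
        intLoad σ j * σ.var 5 := fun j hj => by
      rcases hcase j hj with h | rfl
      · rw [Function.update_of_ne h.ne, h1 j h]
      · simp
    by_cases hc : intLoad σ i ≤ τ.var 11
    · simp only [eval_seq, eval_assign, eval_write, val_mul, val_div, val_var, val_read, hi, h10, ha0,
        ha1, hA, eval_ite, val_sub, Store.setVar_var, Nat.sub_eq_zero_of_le hc, eval_skip,
        Nat.reduceEqDiff, if_true, if_false, Store.setArr_arr, Store.setVar_arr, Store.setArr_var, h5]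
      refine ⟨harr, h2, fun j hj => ?_, ?_⟩
      · rcases hcase j hj with h | rfl
        · exact h3 j h
        · exact hc
      · rcases h4 with h4 | ⟨j, hj, h4⟩
        · exact Or.inl h4
        · exact Or.inr ⟨j, by omega, h4⟩
    · simp only [eval_seq, eval_assign, eval_write, val_mul, val_div, val_var, val_read, hi, h10, ha0,
        ha1, hA, eval_ite, val_sub, Store.setVar_var, Nat.sub_eq_zero_iff_le, hc,
        Nat.reduceEqDiff, if_true, if_false, Store.setArr_arr, Store.setVar_arr, Store.setArr_var, h5]
      refine ⟨harr, by omega, fun j hj => ?_, ?_⟩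
      · rcases hcase j hj with h | rfl
        · have := h3 j h
          omega
        · exact le_rfl
      · exact Or.inr ⟨i, by omega, rfl⟩)
  simpa using key

/-- The position of the job `j` in the order of decreasing demand. -/
def rank (n : ℕ) (x : ℕ → ℕ) (j : ℕ) : ℕ :=
  ((Finset.range n).filter fun k => x j * n + j < x k * n + k).card

theorem rank_lt_rank {n : ℕ} {x : ℕ → ℕ} {j k : ℕ} (hj : j < n)
    (h : x k * n + k < x j * n + j) : rank n x j < rank n x k := by
  refine Finset.card_lt_card ⟨fun i => ?_, fun hsub => ?_⟩
  · simp only [Finset.mem_filter]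
    exact fun hi => ⟨hi.1, h.trans hi.2⟩
  · have := hsub (show j ∈ _ by simp [hj, h])
    simp at this

theorem rank_lt {n : ℕ} (x : ℕ → ℕ) {j : ℕ} (hj : j < n) : rank n x j < n := by
  conv_rhs => rw [← Finset.card_range n]
  refine Finset.card_lt_card ⟨Finset.filter_subset _ _, fun hsub => ?_⟩
  have := hsub (Finset.mem_range.2 hj)
  simp at this

theorem key_lt_key {n x y j k : ℕ} (hj : j < n) (h : x < y) : x * n + j < y * n + k := by
  have := Nat.mul_le_mul_right n (Nat.succ_le_of_lt h)
  rw [Nat.succ_mul] at this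
  omega

theorem rank_injOn {n : ℕ} (x : ℕ → ℕ) {j k : ℕ} (hj : j < n) (hk : k < n)
    (h : rank n x j = rank n x k) : j = k := by
  rcases lt_trichotomy (x j * n + j) (x k * n + k) with h1 | h1 | h1
  · exact absurd h (rank_lt_rank hk h1).ne'
  · rcases lt_trichotomy (x j) (x k) with h2 | h2 | h2
    · exact absurd h1 (key_lt_key hj h2).ne
    · rw [h2] at h1; omega
    · exact absurd h1 (key_lt_key hk h2).ne'
  · exact absurd h (rank_lt_rank hj h1).ne

/-- The ranks form a permutation. -/
noncomputable def rankEquiv (n : ℕ) (x : ℕ → ℕ) : Fin n ≃ Fin n :=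
  Equiv.ofBijective (fun j => ⟨rank n x j, rank_lt x j.2⟩) <| Finite.injective_iff_bijective.1
    fun j k h => Fin.ext (rank_injOn x j.2 k.2 (by simpa using h))

theorem demand_antitone {n : ℕ} (x : ℕ → ℕ) {j k : ℕ} (hj : j < n) (hk : k < n)
    (h : rank n x j ≤ rank n x k) : x k ≤ x j := by
  by_contra hlt
  exact absurd h (not_le.2 (rank_lt_rank hk (key_lt_key hj (not_le.1 hlt))))

theorem order_spec (σ : Store) :
    ∀ j < σ.var 0, (order.eval σ).arr 7 (rank (σ.var 0) (σ.arr 2) j) = j ∧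
      (order.eval σ).arr 8 (rank (σ.var 0) (σ.arr 2) j) = σ.arr 6 j ∧
      (order.eval σ).arr 9 (rank (σ.var 0) (σ.arr 2) j) = σ.arr 2 j := by
  refine eval_upto (x := 18) (y := 0) (fun i τ =>
    ∀ j < i, τ.arr 7 (rank (σ.var 0) (σ.arr 2) j) = j ∧
      τ.arr 8 (rank (σ.var 0) (σ.arr 2) j) = σ.arr 6 j ∧
      τ.arr 9 (rank (σ.var 0) (σ.arr 2) j) = σ.arr 2 j) (by simp) ?_
  intro i hin τ hi hv ha h
  have h0 : τ.var 0 = σ.var 0 := by simpa using hv 0 (by decide)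
  have ha2 : τ.arr 2 = σ.arr 2 := by simpa using ha 2 (by decide)
  have ha6 : τ.arr 6 = σ.arr 6 := by simpa using ha 6 (by decide)
  simp only [eval_seq]
  set L := LProg.upto 19 0 (ite ((read 2 (var 19) * var 0 + var 19) -
    (read 2 (var 18) * var 0 + var 18)) (assign 21 (var 21 + const 1)) skip) with hL
  have hrank : (L.eval ((assign 21 (const 0)).eval τ)).var 21 = rank (σ.var 0) (σ.arr 2) i := by
    rw [show rank (σ.var 0) (σ.arr 2) i = rank ((τ.setVar 21 0).var 0) (σ.arr 2) i by simp [h0]]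
    have hn0 : ((assign 21 (const 0)).eval τ).var 0 = σ.var 0 := by simp [h0]
    have := eval_upto (x := 19) (y := 0) (σ := (assign 21 (const 0)).eval τ)
      (P := ite ((read 2 (var 19) * var 0 + var 19) -
        (read 2 (var 18) * var 0 + var 18)) (assign 21 (var 21 + const 1)) skip)
      (fun m υ => υ.var 21 = ((Finset.range m).filter fun k =>
        σ.arr 2 i * σ.var 0 + i < σ.arr 2 k * σ.var 0 + k).card) (by simp) (by
        intro m hm υ hmv hυ hυa hc
        have e0 : υ.var 0 = σ.var 0 := by rw [hυ 0 (by decide)]; exact hn0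
        have e18 : υ.var 18 = i := by rw [hυ 18 (by decide)]; simpa using hi
        have e2 : υ.arr 2 = σ.arr 2 := by rw [hυa 2 (by decide)]; simpa using ha2
        rw [Finset.range_add_one, Finset.filter_insert]
        simp only [eval_ite, val_sub, val_add, val_mul, val_read, val_var, e0, e18, e2, hmv]
        split_ifs with h1 h2 h2
        · omega
        · simpa using hc
        · rw [Finset.card_insert_of_notMem (by simp)]; simpa using hc
        · omega)
    rw [hn0] at this
    rw [hL, this]; simp [rank, h0]
  have hLv : ∀ z, z ∉ [19, 21] → (L.eval ((assign 21 (const 0)).eval τ)).var z = τ.var z := by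
    intro z hz
    rw [eval_var_of_notMem _ _ _ (by simpa [hL, modVar] using hz)]
    simp at hz; simp [hz]
  have hLa : (L.eval ((assign 21 (const 0)).eval τ)).arr = τ.arr := by
    funext a; rw [eval_arr_of_notMem _ _ _ (by simp [hL, modArr])]; rfl
  generalize L.eval ((assign 21 (const 0)).eval τ) = υ at *
  have e18 : υ.var 18 = i := by rw [hLv 18 (by decide), hi]
  intro j hj
  by_cases hji : j = i
  · subst hji; simp [hrank, e18, hLa, ha6, ha2]
  · have hne : rank (σ.var 0) (σ.arr 2) j ≠ rank (σ.var 0) (σ.arr 2) i := fun e =>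
      hji (rank_injOn _ (by omega) hin e)
    simpa [hrank, e18, hLa, ha6, ha2, Function.update_of_ne hne] using h j (by omega)

/-! ### Verification of the bundling and of the table -/

theorem bundle_spec (σ : Store) :
    IsBundling (σ.var 5) (σ.var 12) (σ.arr 8) (σ.var 0) ((bundle.eval σ).arr 10)
      ((bundle.eval σ).arr 11) ((bundle.eval σ).var 13) := by
  refine eval_upto (x := 18) (y := 0) (σ := σ.setVar 13 0) (fun i τ =>
    IsBundling (σ.var 5) (σ.var 12) (σ.arr 8) i (τ.arr 10) (τ.arr 11) (τ.var 13))
    (by simpa using isBundling_zero ..) ?_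
  intro i _ τ hi hv ha h
  have h5 : τ.var 5 = σ.var 5 := by simpa using hv 5 (by decide)
  have h12 : τ.var 12 = σ.var 12 := by simpa using hv 12 (by decide)
  have h8 : τ.arr 8 = σ.arr 8 := by simpa using ha 8 (by decide)
  by_cases hb : σ.var 12 < σ.arr 8 i * σ.var 5
  · have hb' : ¬ σ.arr 8 i * σ.var 5 ≤ σ.var 12 := not_le.2 hb
    simpa [eval_ite, hi, h5, h12, h8, Nat.sub_eq_zero_iff_le, hb'] using h.big hb
  · have hb' := not_lt.1 hb
    by_cases ho : τ.var 13 = 0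
    · by_cases hf : σ.var 12 < σ.arr 8 i * σ.var 5
      · omega
      · refine h.small (l := i) hb' (Or.inr ⟨ho, rfl⟩) ?_ rfl ?_ ?_ <;>
          simp [eval_ite, hi, h5, h12, h8, hb', ho, hb]
    · obtain ⟨l, hl⟩ := Nat.exists_eq_succ_of_ne_zero ho
      have hli : l ≠ i := (h.open_lead l hl).1.ne
      by_cases hf : (τ.arr 11 l + σ.arr 8 i) * σ.var 5 ≤ σ.var 12
      · refine h.small (l := l) hb' (Or.inl hl) ?_ rfl ?_ ?_ <;>
          simp [eval_ite, hi, h5, h12, h8, hb', hl, hf, hli, not_lt.2 hf]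
      · refine h.small (l := l) hb' (Or.inl hl) ?_ rfl ?_ ?_ <;>
          simp [eval_ite, hi, h5, h12, h8, hb', Nat.sub_eq_zero_iff_le, hl, hf, hli, not_le.1 hf]

theorem round_spec (σ : Store) (hl : ∀ i < σ.var 0, σ.arr 10 i ≤ i) :
    ∀ i < σ.var 0, (round.eval σ).arr 12 i =
      rounded (σ.var 5) (σ.var 12) (σ.arr 10) (σ.arr 11) i := by
  refine eval_upto (x := 18) (y := 0) (fun m τ => ∀ i < m, τ.arr 12 i =
      rounded (σ.var 5) (σ.var 12) (σ.arr 10) (σ.arr 11) i) (by simp) ?_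
  intro m hm τ hi hv ha h i him
  have h5 : τ.var 5 = σ.var 5 := by simpa using hv 5 (by decide)
  have h12 : τ.var 12 = σ.var 12 := by simpa using hv 12 (by decide)
  have h10 : τ.arr 10 = σ.arr 10 := by simpa using ha 10 (by decide)
  have h11 : τ.arr 11 = σ.arr 11 := by simpa using ha 11 (by decide)
  have hlm := hl m hm
  by_cases hc : σ.arr 10 m = m
  · by_cases hmi : i = m
    · subst hmi
      simp [eval_ite, hi, h10, hc, h5, h12, h11, rounded]
    · simpa [eval_ite, hi, h10, hc, Function.update_of_ne hmi] using h i (by omega)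
  · have hc' : ¬ m ≤ σ.arr 10 m := by omega
    by_cases hmi : i = m
    · subst hmi
      simp [eval_ite, hi, h10, hc', hc, Nat.sub_eq_zero_iff_le, rounded]
    · simpa [eval_ite, hi, h10, hc', Nat.sub_eq_zero_iff_le, Function.update_of_ne hmi]
        using h i (by omega)

/-- The candidate for a table entry in which the bundle goes to a core of level `l`. -/
def candidate (σ : Store) (l : ℕ) : ℕ :=
  σ.arr 13 (σ.var 23 + σ.var 8 + (σ.var 25 - σ.arr 5 l + σ.arr 5 (l + σ.arr 12 (σ.var 22)))) +
    if l = 0 then σ.arr 9 (σ.var 22) else 0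

/-- A core of level `l` exists in the state of the code `25` and can take the bundle. -/
def Allowed (σ : Store) (l : ℕ) : Prop :=
  l + σ.arr 12 (σ.var 22) < σ.var 6 ∧
    σ.var 25 / σ.arr 5 l - σ.var 25 / σ.arr 5 l / σ.var 7 * σ.var 7 ≠ 0

instance (σ : Store) (l : ℕ) : Decidable (Allowed σ l) := inferInstanceAs (Decidable (_ ∧ _))

theorem entry_spec (σ : Store) : ∃ v,
    (entry.eval σ).arr 13 = Function.update (σ.arr 13) (σ.var 23 + σ.var 25) v ∧
      (∀ l < σ.var 6, Allowed σ l → v ≤ candidate σ l) ∧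
      (v ≤ σ.var 2 → ∃ l < σ.var 6, Allowed σ l ∧ candidate σ l ≤ v) := by
  simp only [entry, eval_seq, eval_write]
  set P := assign 24 (var 19 + read 12 (var 22)) ;;
    ite (var 6 - var 24) (
      ite (var 25 / read 5 (var 19) - var 25 / read 5 (var 19) / var 7 * var 7) (
        assign 26 (read 13 (var 23 + var 8 + (var 25 - read 5 (var 19) + read 5 (var 24)))) ;;
        ite (var 19) skip (assign 26 (var 26 + read 9 (var 22))) ;;
        ite (var 15 - var 26) (assign 15 (var 26)) skip) skip) skip with hP
  have key := eval_upto (x := 19) (y := 6) (P := P)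
    (σ := (assign 15 (var 2 + const 1)).eval σ) (fun m τ =>
      (∀ l < m, Allowed σ l → τ.var 15 ≤ candidate σ l) ∧
      (τ.var 15 ≤ σ.var 2 → ∃ l < m, Allowed σ l ∧ candidate σ l ≤ τ.var 15)) (by simp) (by
    rintro m - τ hm hv ha ⟨h1, h2⟩
    have h22 : τ.var 22 = σ.var 22 := by simpa using hv 22 (by decide)
    have h6 : τ.var 6 = σ.var 6 := by simpa using hv 6 (by decide)
    have h25 : τ.var 25 = σ.var 25 := by simpa using hv 25 (by decide)
    have h7 : τ.var 7 = σ.var 7 := by simpa using hv 7 (by decide)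
    have h23 : τ.var 23 = σ.var 23 := by simpa using hv 23 (by decide)
    have h8 : τ.var 8 = σ.var 8 := by simpa using hv 8 (by decide)
    have ha' : τ.arr = σ.arr := by funext a; rw [ha a (by simp [hP, modArr])]; rfl
    have hnew : ((P.eval τ).setVar 19 (m + 1)).var 15 =
        if Allowed σ m ∧ candidate σ m < τ.var 15 then candidate σ m else τ.var 15 := by
      by_cases c1 : m + σ.arr 12 (σ.var 22) < σ.var 6
      · by_cases c2 : σ.var 25 / σ.arr 5 m - σ.var 25 / σ.arr 5 m / σ.var 7 * σ.var 7 = 0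
        · rw [if_neg fun h => h.1.2 c2]
          simp [hP, eval_ite, hm, h22, h6, h25, h7, ha', Nat.sub_eq_zero_iff_le, not_le.2 c1, c2]
        · have hal : Allowed σ m := ⟨c1, c2⟩
          simp only [hal, true_and]
          have c1' := not_le.2 c1
          by_cases c4 : m = 0
          · subst c4
            rw [zero_add] at c1'
            simp only [candidate, if_true, zero_add]
            simp [hP, eval_ite, Store.ite_var, hm, h22, h6, h25, h7, h23, h8, ha',
              Nat.sub_eq_zero_iff_le, c1', c2]
            split_ifs <;> omega
          · simp only [candidate, c4, if_false, add_zero]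
            simp [hP, eval_ite, Store.ite_var, hm, h22, h6, h25, h7, h23, h8, ha',
              Nat.sub_eq_zero_iff_le, c1', c2, c4]
            split_ifs <;> omega
      · rw [if_neg fun h => c1 h.1.1]
        simp [hP, eval_ite, hm, h22, h6, ha', not_lt.1 c1]
    rw [hnew]
    have hcase : ∀ j < m + 1, j < m ∨ j = m := fun j hj => by omega
    split_ifs with hc
    · refine ⟨fun l hl hal => ?_, fun _ => ⟨m, by omega, hc.1, le_rfl⟩⟩
      rcases hcase l hl with h | rfl
      · exact hc.2.le.trans (h1 l h hal)
      · exact le_rfl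
    · refine ⟨fun l hl hal => ?_, fun hle => ?_⟩
      · rcases hcase l hl with h | rfl
        · exact h1 l h hal
        · exact not_lt.1 fun h => hc ⟨hal, h⟩
      · obtain ⟨l, hl, h⟩ := h2 hle
        exact ⟨l, by omega, h⟩)
  set υ := (LProg.upto 19 6 P).eval ((assign 15 (var 2 + const 1)).eval σ) with hυ
  have h23 : υ.var 23 = σ.var 23 := by rw [hυ, eval_var_of_notMem _ _ _ (by decide)]; simp
  have h25 : υ.var 25 = σ.var 25 := by rw [hυ, eval_var_of_notMem _ _ _ (by decide)]; simp
  have ha : υ.arr = σ.arr := by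
    funext a; rw [hυ, eval_arr_of_notMem _ _ _ (by simp [hP, modArr])]; rfl
  refine ⟨υ.var 15, by simp [h23, h25, ha], ?_⟩
  simpa using key

theorem IsEntry.congr {B L W K i c : ℕ} {r x V V' r' x' : ℕ → ℕ} {lev : Fin c → ℕ}
    (h : IsEntry B L W K r x V i lev) (hr : r' i = r i) (hx : x' i = x i)
    (h0 : V' (i * W + enc B lev) = V (i * W + enc B lev))
    (h1 : ∀ k, (i + 1) * W ≤ k → V' k = V k) : IsEntry B L W K r' x' V' i lev := by
  have hs : ∀ t, stepCost B W r' x' V' i lev t = stepCost B W r x V i lev t := fun t => by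
    simp only [stepCost, hr, hx]; rw [h1 _ (Nat.le_add_right _ _)]
  constructor
  · intro t ht
    rw [hs, h0]; exact h.le t (by rwa [hr] at ht)
  · intro hK
    rw [h0] at hK ⊢
    obtain ⟨t, ht, hle⟩ := h.exists_le hK
    exact ⟨t, by rwa [hr], by rwa [hs]⟩

/-- The facts about powers of the base which stay true in the main part of the program. -/
structure HasPowers (σ : Store) : Prop where
  base : σ.var 7 = σ.var 1 + 1
  count : σ.var 8 = σ.var 7 ^ σ.var 6
  power : ∀ l < σ.var 6, σ.arr 5 l = σ.var 7 ^ l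

theorem HasPowers.congr {σ τ : Store} (h : HasPowers σ)
    (hv : ∀ z ∈ [1, 6, 7, 8], τ.var z = σ.var z) (ha : τ.arr 5 = σ.arr 5) : HasPowers τ := by
  have h1 := hv 1 (by decide)
  have h6 := hv 6 (by decide)
  have h7 := hv 7 (by decide)
  have h8 := hv 8 (by decide)
  constructor
  · rw [h1, h7, h.base]
  · rw [h6, h7, h8, h.count]
  · rw [h6, h7, ha]; exact h.power

theorem entry_isEntry {σ : Store} (hp : HasPowers σ) (h23 : σ.var 23 = σ.var 22 * σ.var 8) :
    ∃ v, (entry.eval σ).arr 13 = Function.update (σ.arr 13) (σ.var 23 + σ.var 25) v ∧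
      ∀ lev : Fin (σ.var 1) → ℕ, (∀ t, lev t < σ.var 6) → enc (σ.var 7) lev = σ.var 25 →
        IsEntry (σ.var 7) (σ.var 6) (σ.var 8) (σ.var 2) (σ.arr 12) (σ.arr 9)
          ((entry.eval σ).arr 13) (σ.var 22) lev := by
  obtain ⟨v, hV, h1, h2⟩ := entry_spec σ
  refine ⟨v, hV, fun lev hlev hN => ?_⟩
  have hB : σ.var 1 < σ.var 7 := by rw [hp.base]; omega
  have hNW : σ.var 25 < σ.var 8 := by rw [← hN, hp.count]; exact enc_lt hB lev hlev
  have hcell : (entry.eval σ).arr 13 (σ.var 22 * σ.var 8 + enc (σ.var 7) lev) = v := by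
    rw [hV, hN, h23]; simp
  have hcand : ∀ t, lev t + σ.arr 12 (σ.var 22) < σ.var 6 →
      stepCost (σ.var 7) (σ.var 8) (σ.arr 12) (σ.arr 9) ((entry.eval σ).arr 13) (σ.var 22) lev t =
        candidate σ (lev t) := by
    intro t ht
    simp only [stepCost, candidate]
    rw [enc_update, hN, hp.power _ (hlev t), hp.power _ ht, h23, hV, Function.update_of_ne]
    · congr 2; ring
    · rw [add_mul, h23]; omega
  have hallow : ∀ t, lev t + σ.arr 12 (σ.var 22) < σ.var 6 → Allowed σ (lev t) := by
    intro t ht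
    refine ⟨ht, ?_⟩
    rw [hp.power _ (hlev t), ← hN, enc_digit hB]
    exact Finset.card_ne_zero_of_mem (a := t) (by simp)
  constructor
  · intro t ht
    rw [hcell, hcand t ht]
    exact h1 _ (hlev t) (hallow t ht)
  · intro hK
    rw [hcell] at hK ⊢
    obtain ⟨l, hl, hal, hle⟩ := h2 hK
    have hd := hal.2
    rw [hp.power _ hl, ← hN, enc_digit hB] at hd
    obtain ⟨t, ht⟩ := Finset.card_pos.1 (Nat.pos_of_ne_zero hd)
    obtain rfl : lev t = l := by simpa using ht
    exact ⟨t, hal.1, by rw [hcand t hal.1]; exact hle⟩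

theorem row_spec {σ : Store} (hp : HasPowers σ) (h23 : σ.var 23 = σ.var 22 * σ.var 8) :
    (∀ k, σ.var 23 + σ.var 8 ≤ k →
      ((LProg.upto 25 8 entry).eval σ).arr 13 k = σ.arr 13 k) ∧
    ∀ lev : Fin (σ.var 1) → ℕ, (∀ t, lev t < σ.var 6) →
      IsEntry (σ.var 7) (σ.var 6) (σ.var 8) (σ.var 2) (σ.arr 12) (σ.arr 9)
        (((LProg.upto 25 8 entry).eval σ).arr 13) (σ.var 22) lev := by
  have key := eval_upto (x := 25) (y := 8) (P := entry) (σ := σ) (fun m τ =>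
    (∀ k, σ.var 23 + σ.var 8 ≤ k → τ.arr 13 k = σ.arr 13 k) ∧
    ∀ lev : Fin (σ.var 1) → ℕ, (∀ t, lev t < σ.var 6) → enc (σ.var 7) lev < m →
      IsEntry (σ.var 7) (σ.var 6) (σ.var 8) (σ.var 2) (σ.arr 12) (σ.arr 9)
        (τ.arr 13) (σ.var 22) lev) (by simp) (by
    rintro m hm τ h25 hv ha ⟨h1, h2⟩
    have hv' : ∀ z ∈ [1, 2, 6, 7, 8, 22, 23], τ.var z = σ.var z := fun z hz =>
      hv z (by revert z; decide)
    have ha' : ∀ a ∈ [5, 9, 12], τ.arr a = σ.arr a := fun a hz => ha a (by revert a; decide)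
    have hpτ : HasPowers τ := hp.congr (fun z hz => hv' z (by revert z; decide)) (ha' 5 (by decide))
    have e1 := hv' 1 (by decide)
    have e2 := hv' 2 (by decide)
    have e6 := hv' 6 (by decide)
    have e7 := hv' 7 (by decide)
    have e8 := hv' 8 (by decide)
    have e22 := hv' 22 (by decide)
    have e23 := hv' 23 (by decide)
    have a9 := ha' 9 (by decide)
    have a12 := ha' 12 (by decide)
    obtain ⟨v, hV, h3⟩ := entry_isEntry hpτ (by rw [e23, e22, e8, h23])
    rw [e1, e6, e7, e8, e2, e22, a9, a12, h25] at h3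
    rw [e23, h25] at hV
    simp only [Store.setVar_arr]
    refine ⟨fun k hk => ?_, fun lev hlev hlt => ?_⟩
    · rw [hV, Function.update_of_ne (by omega)]; exact h1 k hk
    · rcases (Nat.lt_succ_iff_lt_or_eq.1 hlt) with h | h
      · refine (h2 lev hlev h).congr rfl rfl ?_ fun k hk => ?_
        · rw [hV, Function.update_of_ne (by rw [h23]; omega)]
        · rw [add_mul] at hk
          rw [hV, Function.update_of_ne (by rw [h23]; omega)]
      · exact h3 lev hlev h)
  refine ⟨key.1, fun lev hlev => key.2 lev hlev ?_⟩
  rw [hp.count]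
  exact enc_lt (by rw [hp.base]; omega) lev hlev

theorem table_spec {σ : Store} (hp : HasPowers σ) :
    (∀ k, σ.var 0 * σ.var 8 ≤ k → (table.eval σ).arr 13 k = σ.arr 13 k) ∧
    ∀ i < σ.var 0, ∀ lev : Fin (σ.var 1) → ℕ, (∀ t, lev t < σ.var 6) →
      IsEntry (σ.var 7) (σ.var 6) (σ.var 8) (σ.var 2) (σ.arr 12) (σ.arr 9)
        ((table.eval σ).arr 13) i lev := by
  have key := eval_upto (x := 18) (y := 0) (σ := σ)
    (P := assign 22 (var 0 - const 1 - var 18) ;; assign 23 (var 22 * var 8) ;; .upto 25 8 entry)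
    (fun m τ => (∀ k, σ.var 0 * σ.var 8 ≤ k → τ.arr 13 k = σ.arr 13 k) ∧
    ∀ i < σ.var 0, σ.var 0 ≤ i + m → ∀ lev : Fin (σ.var 1) → ℕ, (∀ t, lev t < σ.var 6) →
      IsEntry (σ.var 7) (σ.var 6) (σ.var 8) (σ.var 2) (σ.arr 12) (σ.arr 9)
        (τ.arr 13) i lev) (by simp; intros; omega) (by
    rintro m hm τ h18 hv ha ⟨h1, h2⟩
    have hv' : ∀ z ∈ [0, 1, 2, 6, 7, 8], τ.var z = σ.var z := fun z hz =>
      hv z (by revert z; decide)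
    have ha' : ∀ a ∈ [5, 9, 12], τ.arr a = σ.arr a := fun a hz => ha a (by revert a; decide)
    set υ := (assign 23 (var 22 * var 8)).eval ((assign 22 (var 0 - const 1 - var 18)).eval τ)
      with hυ
    have hυv : ∀ z ∈ [0, 1, 2, 6, 7, 8], υ.var z = σ.var z := fun z hz => by
      rw [hυ, eval_var_of_notMem _ _ _ (by revert z; decide),
        eval_var_of_notMem _ _ _ (by revert z; decide), hv' z hz]
    have hυa : υ.arr = τ.arr := rfl
    have hpυ : HasPowers υ := hp.congr (fun z hz => hυv z (by revert z; decide))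
      (by rw [hυa, ha' 5 (by decide)])
    have e0 := hυv 0 (by decide)
    have e1 := hυv 1 (by decide)
    have e2 := hυv 2 (by decide)
    have e6 := hυv 6 (by decide)
    have e7 := hυv 7 (by decide)
    have e8 := hυv 8 (by decide)
    have a9 := ha' 9 (by decide)
    have a12 := ha' 12 (by decide)
    have t0 := hv' 0 (by decide)
    have t8 := hv' 8 (by decide)
    obtain ⟨i₀, hi₀⟩ : ∃ i₀, i₀ = σ.var 0 - 1 - m := ⟨_, rfl⟩
    have e22 : υ.var 22 = i₀ := by simp [hυ, t0, h18, hi₀]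
    have e23 : υ.var 23 = i₀ * σ.var 8 := by simp [hυ, t0, t8, h18, hi₀]
    obtain ⟨h3, h4⟩ := row_spec hpυ (by rw [e23, e22, e8])
    rw [hυa, a9, a12, e1, e2, e6, e7, e8, e22] at h4
    rw [hυa, e23, e8] at h3
    have hev : (assign 22 (var 0 - const 1 - var 18) ;; assign 23 (var 22 * var 8) ;;
        .upto 25 8 entry).eval τ = (LProg.upto 25 8 entry).eval υ := rfl
    rw [hev, Store.setVar_arr]
    refine ⟨fun k hk => ?_, fun i hi him lev hlev => ?_⟩
    · have hle : i₀ * σ.var 8 + σ.var 8 ≤ k := by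
        refine le_trans ?_ hk
        rw [← Nat.succ_mul]; exact Nat.mul_le_mul_right _ (by omega)
      rw [h3 k hle, h1 k hk]
    · rcases eq_or_ne i i₀ with rfl | hne
      · exact h4 lev hlev
      · have hlt : i₀ + 1 ≤ i := by omega
        have hmul := Nat.mul_le_mul_right (σ.var 8) hlt
        rw [add_mul, one_mul] at hmul
        refine (h2 i hi (by omega) lev hlev).congr rfl rfl (h3 _ (by omega)) fun k hk => h3 k ?_
        rw [add_mul] at hk; omega)
  refine ⟨key.1, fun i hi => key.2 i hi (by omega)⟩

/-! ### Verification of the construction of a solution -/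

/-- Placing the next bundle on the core `t` is possible at no more than the cost in the table. -/
def GoodCore (B L W : ℕ) (r x V : ℕ → ℕ) (i : ℕ) {c : ℕ} (lev : Fin c → ℕ) (t : Fin c) : Prop :=
  lev t + r i < L ∧ stepCost B W r x V i lev t ≤ V (i * W + enc B lev)

instance (B L W : ℕ) (r x V : ℕ → ℕ) (i : ℕ) {c : ℕ} (lev : Fin c → ℕ) (t : Fin c) :
    Decidable (GoodCore B L W r x V i lev t) := inferInstanceAs (Decidable (_ ∧ _))

theorem choose_spec {σ : Store} (hp : HasPowers σ) {c : ℕ} (hc : σ.var 1 = c) (lev : Fin c → ℕ)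
    (hlev : ∀ t, lev t < σ.var 6) (h14 : ∀ t : Fin c, σ.arr 14 t = lev t)
    (hN : σ.var 14 = enc (σ.var 7) lev) (h23 : σ.var 23 = σ.var 18 * σ.var 8)
    (hex : ∃ t, GoodCore (σ.var 7) (σ.var 6) (σ.var 8) (σ.arr 12) (σ.arr 9) (σ.arr 13)
      (σ.var 18) lev t) :
    ∃ t : Fin c, (choose.eval σ).var 16 = t ∧
      GoodCore (σ.var 7) (σ.var 6) (σ.var 8) (σ.arr 12) (σ.arr 9) (σ.arr 13) (σ.var 18) lev t := by
  set P := assign 24 (read 14 (var 19) + read 12 (var 18)) ;;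
    ite (var 6 - var 24) (
      assign 26 (read 13 (var 23 + var 8 +
        (var 14 - read 5 (read 14 (var 19)) + read 5 (var 24)))) ;;
      ite (read 14 (var 19)) skip (assign 26 (var 26 + read 9 (var 18))) ;;
      ite (read 13 (var 23 + var 14) + const 1 - var 26) (assign 16 (var 19)) skip) skip with hP
  have key := eval_upto (x := 19) (y := 1) (P := P) (σ := σ) (fun m τ =>
      (∃ t : Fin c, t < m ∧ GoodCore (σ.var 7) (σ.var 6) (σ.var 8) (σ.arr 12) (σ.arr 9)
        (σ.arr 13) (σ.var 18) lev t) →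
      ∃ t : Fin c, τ.var 16 = t ∧ GoodCore (σ.var 7) (σ.var 6) (σ.var 8) (σ.arr 12) (σ.arr 9)
        (σ.arr 13) (σ.var 18) lev t) (by simp) (by
    intro m hm τ h19 hv ha h
    have e6 : τ.var 6 = σ.var 6 := by simpa using hv 6 (by decide)
    have e8 : τ.var 8 = σ.var 8 := by simpa using hv 8 (by decide)
    have e14 : τ.var 14 = σ.var 14 := by simpa using hv 14 (by decide)
    have e18 : τ.var 18 = σ.var 18 := by simpa using hv 18 (by decide)
    have e23 : τ.var 23 = σ.var 23 := by simpa using hv 23 (by decide)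
    have ha' : τ.arr = σ.arr := by funext a; exact ha a (by simp [hP, modArr])
    obtain ⟨t₀, ht₀⟩ : ∃ t₀ : Fin c, (t₀ : ℕ) = m := ⟨⟨m, hc ▸ hm⟩, rfl⟩
    have l14 : σ.arr 14 m = lev t₀ := by rw [← h14, ht₀]
    have hnew : ((P.eval τ).setVar 19 (m + 1)).var 16 =
        if GoodCore (σ.var 7) (σ.var 6) (σ.var 8) (σ.arr 12) (σ.arr 9)
        (σ.arr 13) (σ.var 18) lev t₀ then m else τ.var 16 := by
      by_cases c1 : lev t₀ + σ.arr 12 (σ.var 18) < σ.var 6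
      · have c1' := not_le.2 c1
        have hcost : stepCost (σ.var 7) (σ.var 8) (σ.arr 12) (σ.arr 9) (σ.arr 13) (σ.var 18) lev t₀
            = σ.arr 13 (σ.var 23 + σ.var 8 + (σ.var 14 - σ.arr 5 (lev t₀) +
              σ.arr 5 (lev t₀ + σ.arr 12 (σ.var 18)))) +
              if lev t₀ = 0 then σ.arr 9 (σ.var 18) else 0 := by
          simp only [stepCost]
          rw [enc_update, hN, hp.power _ (hlev t₀), hp.power _ c1, h23, add_mul, one_mul]
        simp only [GoodCore, c1, true_and, hcost, ← hN, ← h23]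
        by_cases c4 : lev t₀ = 0
        · rw [c4] at l14 c1'
          rw [zero_add] at c1'
          simp only [c4, if_true, zero_add]
          simp [hP, eval_ite, Store.ite_var, h19, e6, e8, e14, e18, e23, ha', l14,
            Nat.sub_eq_zero_iff_le, c1']
          split_ifs <;> omega
        · simp only [c4, if_false, add_zero]
          simp [hP, eval_ite, Store.ite_var, h19, e6, e8, e14, e18, e23, ha', l14,
            Nat.sub_eq_zero_iff_le, c1', c4]
          split_ifs <;> omega
      · rw [if_neg fun h => c1 h.1]
        simp [hP, eval_ite, h19, e6, e18, ha', l14, not_lt.1 c1]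
    rw [hnew]
    rintro ⟨t, htm, ht⟩
    split_ifs with hg
    · exact ⟨t₀, ht₀.symm, hg⟩
    · refine h ⟨t, ?_, ht⟩
      refine lt_of_le_of_ne (by omega) fun e => hg ?_
      rwa [show t₀ = t from Fin.ext (by omega)])
  obtain ⟨t, ht⟩ := hex
  rw [hc] at key
  exact key ⟨t, t.2, ht⟩

/-- The invariant of the construction after `i` positions. -/
structure Constructing (σ : Store) (c K n : ℕ) (i : ℕ) (τ : Store) : Prop where
  core_lt : ∀ k < i, τ.arr 15 k < c
  level : ∀ t : Fin c, τ.arr 14 t =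
    ∑ k ∈ (Finset.range i).filter (fun k => τ.arr 15 k = t), σ.arr 12 k
  level_lt : ∀ t : Fin c, τ.arr 14 t < σ.var 6
  code : τ.var 14 = enc (σ.var 7) (fun t : Fin c => τ.arr 14 t)
  value_le : σ.arr 13 (i * σ.var 8 + τ.var 14) ≤ τ.var 17
  cache_sum : τ.var 17 + ∑ t : Fin c, τ.arr 3 t = K
  demand_le : ∀ k < i, σ.arr 9 k ≤ τ.arr 3 (τ.arr 15 k)
  opened : ∀ t : Fin c, τ.arr 14 t ≠ 0 → ∀ k, i ≤ k → k < n → σ.arr 9 k ≤ τ.arr 3 t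
  output : ∀ k < i, τ.arr 4 (σ.arr 7 k) = τ.arr 15 (σ.arr 10 k)

theorem sum_update_fin {c : ℕ} (f : ℕ → ℕ) (t₀ : Fin c) (v : ℕ) :
    ∑ t : Fin c, Function.update f t₀ (f t₀ + v) t = ∑ t : Fin c, f t + v := by
  rw [← Finset.add_sum_erase _ _ (Finset.mem_univ t₀),
    ← Finset.add_sum_erase _ (fun t : Fin c => f t) (Finset.mem_univ t₀)]
  rw [Finset.sum_congr rfl fun t ht => Function.update_of_ne
    (fun e => Finset.ne_of_mem_erase ht (Fin.ext e)) _ _, Function.update_self]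
  omega

theorem construct_step {σ τ : Store} (hp : HasPowers σ) {i c K n : ℕ} (hc : σ.var 1 = c)
    (hV : ∀ i < n, ∀ lev : Fin c → ℕ, (∀ t, lev t < σ.var 6) →
      IsEntry (σ.var 7) (σ.var 6) (σ.var 8) K (σ.arr 12) (σ.arr 9) (σ.arr 13) i lev)
    (hx : ∀ i j, i ≤ j → j < n → σ.arr 9 j ≤ σ.arr 9 i)
    (hord : ∀ i j, i < n → j < n → σ.arr 7 i = σ.arr 7 j → i = j)
    (hlead : ∀ k < n, σ.arr 10 k ≤ k) (hi : i < n) (h18 : τ.var 18 = i)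
    (hv : ∀ z ∈ [1, 6, 7, 8], τ.var z = σ.var z)
    (ha : ∀ a ∈ [5, 7, 9, 10, 12, 13], τ.arr a = σ.arr a)
    (h : Constructing σ c K n i τ) :
    Constructing σ c K n (i + 1)
      ((assign 23 (var 18 * var 8) ;; choose ;; place).eval τ) := by
  have e1 := hv 1 (by decide)
  have e6 := hv 6 (by decide)
  have e7 := hv 7 (by decide)
  have e8 := hv 8 (by decide)
  have a5 := ha 5 (by decide)
  have a7 := ha 7 (by decide)
  have a9 := ha 9 (by decide)
  have a10 := ha 10 (by decide)
  have a12 := ha 12 (by decide)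
  have a13 := ha 13 (by decide)
  set lev : Fin c → ℕ := fun t => τ.arr 14 t with hlev
  simp only [eval_seq]
  set υ := (assign 23 (var 18 * var 8)).eval τ with hυ
  have hpυ : HasPowers υ := hp.congr (fun z hz => by
    rw [hυ, eval_var_of_notMem _ _ _ (by revert z; decide), hv z hz]) a5
  have hυa : υ.arr = τ.arr := rfl
  have hle : σ.arr 13 (i * σ.var 8 + enc (σ.var 7) lev) ≤ K := by
    have h1 := h.value_le
    have h2 := h.cache_sum
    rw [show τ.var 14 = enc (σ.var 7) lev from h.code] at h1; omega
  obtain ⟨t₀, ht₀, hg⟩ := choose_spec hpυ (c := c) (by simp [hυ, e1, hc]) lev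
    (by simpa [hυ, e6] using h.level_lt) (by simp [hυ, hlev])
    (by simpa [hυ, e7] using h.code) (by simp [hυ]) (by
      obtain ⟨t, h1, h2⟩ := (hV i hi lev h.level_lt).exists_le hle
      exact ⟨t, by simpa [hυ, e6, e7, e8, a12, a9, a13, h18] using
        (show GoodCore (σ.var 7) (σ.var 6) (σ.var 8) (σ.arr 12) (σ.arr 9) (σ.arr 13) i lev t from
          ⟨h1, h2⟩)⟩)
  have hg : GoodCore (σ.var 7) (σ.var 6) (σ.var 8) (σ.arr 12) (σ.arr 9) (σ.arr 13) i lev t₀ := by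
    simpa [hυ, e6, e7, e8, a12, a9, a13, h18] using hg
  set ρ := choose.eval υ with hρ
  have r14 : ρ.var 14 = τ.var 14 := by
    rw [hρ, eval_var_of_notMem _ _ _ (by decide)]; simp [hυ]
  have r17 : ρ.var 17 = τ.var 17 := by
    rw [hρ, eval_var_of_notMem _ _ _ (by decide)]; simp [hυ]
  have r18 : ρ.var 18 = i := by
    rw [hρ, eval_var_of_notMem _ _ _ (by decide)]; simp [hυ, h18]
  have ra : ρ.arr = τ.arr := by
    funext a; rw [hρ, eval_arr_of_notMem _ _ _ (by simp [choose, modArr])]; rfl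
  obtain ⟨hgL, hgle⟩ := hg
  have hlt₀ : τ.arr 14 t₀ = lev t₀ := rfl
  have A15 : (place.eval ρ).arr 15 = Function.update (τ.arr 15) i t₀ := by
    simp [place, eval_ite, Store.ite_arr, Store.ite_var, ht₀, r18, ra]
  have A14 : (place.eval ρ).arr 14 =
      Function.update (τ.arr 14) t₀ (lev t₀ + σ.arr 12 i) := by
    simp [place, eval_ite, Store.ite_arr, Store.ite_var, ht₀, r18, ra, a12, hlt₀]
  have A3 : (place.eval ρ).arr 3 = Function.update (τ.arr 3) t₀
      (τ.arr 3 t₀ + if lev t₀ = 0 then σ.arr 9 i else 0) := by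
    by_cases h0 : lev t₀ = 0 <;>
      simp [place, eval_ite, ht₀, r18, ra, a9, hlt₀, h0]
  have V17 : (place.eval ρ).var 17 = τ.var 17 - if lev t₀ = 0 then σ.arr 9 i else 0 := by
    by_cases h0 : lev t₀ = 0 <;>
      simp [place, eval_ite, ht₀, r18, r17, ra, a9, hlt₀, h0]
  have V14 : (place.eval ρ).var 14 =
      enc (σ.var 7) (Function.update lev t₀ (lev t₀ + σ.arr 12 i)) := by
    rw [enc_update, ← hp.power _ (h.level_lt t₀), ← hp.power _ hgL, ← h.code]
    by_cases h0 : lev t₀ = 0 <;>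
      simp [place, eval_ite, ht₀, r18, r14, ra, a5, a12, hlt₀, h0]
  have A4 : (place.eval ρ).arr 4 = Function.update (τ.arr 4) (σ.arr 7 i)
      (Function.update (τ.arr 15) i t₀ (σ.arr 10 i)) := by
    simp [place, eval_ite, Store.ite_arr, Store.ite_var, ht₀, r18, ra, a7, a10]
  set ω := place.eval ρ with hω
  have hcase : ∀ j < i + 1, j < i ∨ j = i := fun j hj => by omega
  have hcode : (fun t : Fin c => ω.arr 14 t) =
      Function.update lev t₀ (lev t₀ + σ.arr 12 i) := by
    funext t
    rw [A14]
    by_cases ht : t = t₀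
    · subst ht; simp
    · rw [Function.update_of_ne ht, Function.update_of_ne fun e => ht (Fin.ext e)]
  rw [stepCost, ← h.code] at hgle
  have hvle := h.value_le
  constructor
  · intro k hk
    rw [A15]
    rcases hcase k hk with h1 | rfl
    · rw [Function.update_of_ne h1.ne]; exact h.core_lt k h1
    · simp
  · intro t
    rw [A15]
    simp only [Finset.sum_filter, Finset.sum_range_succ, Function.update_self]
    have : ∑ k ∈ Finset.range i, (if Function.update (τ.arr 15) i t₀ k = t then σ.arr 12 k else 0) =
        τ.arr 14 t := by
      rw [h.level t, Finset.sum_filter]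
      exact Finset.sum_congr rfl fun k hk => by
        rw [Function.update_of_ne (Finset.mem_range.1 hk).ne]
    rw [this, A14]
    by_cases ht : t = t₀
    · subst ht; simp [hlt₀]
    · have ht' : (t : ℕ) ≠ t₀ := fun e => ht (Fin.ext e)
      rw [Function.update_of_ne ht', if_neg (Ne.symm ht'), add_zero]
  · intro t
    rw [A14]
    by_cases ht : t = t₀
    · subst ht; simpa using hgL
    · rw [Function.update_of_ne fun e => ht (Fin.ext e)]; exact h.level_lt t
  · rw [V14, hcode]
  · rw [V14, V17]; omega
  · rw [A3, sum_update_fin, V17]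
    have := h.cache_sum
    omega
  · intro k hk
    have hmono : ∀ j, τ.arr 3 j ≤ ω.arr 3 j := fun j => by
      rw [A3]
      by_cases hj : j = t₀
      · subst hj; simp
      · rw [Function.update_of_ne hj]
    rcases hcase k hk with h1 | rfl
    · rw [A15, Function.update_of_ne h1.ne]
      exact (h.demand_le k h1).trans (hmono _)
    · rw [A15, Function.update_self, A3, Function.update_self]
      by_cases h0 : lev t₀ = 0
      · rw [if_pos h0]; omega
      · exact (h.opened t₀ h0 k le_rfl hi).trans (Nat.le_add_right _ _)
  · intro t ht k hk hkn
    rw [A3]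
    by_cases htt : t = t₀
    · subst htt
      rw [Function.update_self]
      by_cases h0 : lev t = 0
      · rw [if_pos h0]
        exact (hx i k (by omega) hkn).trans (Nat.le_add_left _ _)
      · exact (h.opened t h0 k (by omega) hkn).trans (Nat.le_add_right _ _)
    · have htt' : (t : ℕ) ≠ t₀ := fun e => htt (Fin.ext e)
      rw [A14, Function.update_of_ne htt'] at ht
      rw [Function.update_of_ne htt']
      exact h.opened t ht k (by omega) hkn
  · intro k hk
    rw [A15, A4]
    rcases hcase k hk with h1 | rfl
    · rw [Function.update_of_ne fun e => h1.ne (hord k i (by omega) hi e), h.output k h1,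
        Function.update_of_ne]
      have := hlead k (by omega); omega
    · simp

/-- What the construction achieves. -/
theorem construct_spec {σ : Store} (hp : HasPowers σ) {c K n : ℕ} (hn : σ.var 0 = n)
    (hc : σ.var 1 = c) (hK : σ.var 2 = K)
    (hV : ∀ i < n, ∀ lev : Fin c → ℕ, (∀ t, lev t < σ.var 6) →
      IsEntry (σ.var 7) (σ.var 6) (σ.var 8) K (σ.arr 12) (σ.arr 9) (σ.arr 13) i lev)
    (hVc : σ.arr 13 c ≤ K) (h6 : 0 < σ.var 6)
    (hx : ∀ i j, i ≤ j → j < n → σ.arr 9 j ≤ σ.arr 9 i)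
    (hord : ∀ i j, i < n → j < n → σ.arr 7 i = σ.arr 7 j → i = j)
    (hlead : ∀ k < n, σ.arr 10 k ≤ k) :
    ∃ g : ℕ → ℕ, (∀ k < n, g k < c) ∧
      (∀ t : Fin c, ∑ k ∈ (Finset.range n).filter (fun k => g k = t), σ.arr 12 k < σ.var 6) ∧
      (∀ k < n, (construct.eval σ).arr 4 (σ.arr 7 k) = g (σ.arr 10 k)) ∧
      (∀ k < n, σ.arr 9 k ≤ (construct.eval σ).arr 3 (g k)) ∧
      (0 < c → ∑ t : Fin c, (construct.eval σ).arr 3 t = K) := by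
  simp only [construct, eval_seq]
  set σ₁ := (assign 14 (var 1)).eval ((assign 17 (var 2)).eval σ) with hσ₁
  set Z := LProg.upto 19 1 (write 14 (var 19) (const 0) ;; write 3 (var 19) (const 0)) with hZ
  have hinit := eval_upto (x := 19) (y := 1) (σ := σ₁)
    (P := write 14 (var 19) (const 0) ;; write 3 (var 19) (const 0))
    (fun m τ => ∀ t < m, τ.arr 14 t = 0 ∧ τ.arr 3 t = 0) (by simp) (by
      intro m _ τ h19 _ _ h t ht
      by_cases htm : t = m
      · subst htm; simp [h19]
      · simpa [h19, Function.update_of_ne htm] using h t (by omega))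
  rw [← hZ] at hinit
  have hc₁ : σ₁.var 1 = c := by simp [hσ₁, hc]
  rw [hc₁] at hinit
  set σ₂ := Z.eval σ₁ with hσ₂
  have hv₂ : ∀ z, z ∉ [14, 17, 19] → σ₂.var z = σ.var z := fun z hz => by
    rw [hσ₂, eval_var_of_notMem _ _ _ (by simp [hZ, modVar]; simp at hz; tauto)]
    simp at hz; simp [hσ₁, hz]
  have ha₂ : ∀ a, a ∉ [3, 14] → σ₂.arr a = σ.arr a := fun a hz => by
    rw [hσ₂, eval_arr_of_notMem _ _ _ (by simp [hZ, modArr]; simp at hz; tauto)]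
    simp [hσ₁]
  have h14 : σ₂.var 14 = c := by
    rw [hσ₂, eval_var_of_notMem _ _ _ (by decide)]; simp [hσ₁, hc]
  have h17 : σ₂.var 17 = K := by
    rw [hσ₂, eval_var_of_notMem _ _ _ (by decide)]; simp [hσ₁, hK]
  set Bd := assign 23 (var 18 * var 8) ;; choose ;; place with hBd
  have hn₂ : σ₂.var 0 = n := by rw [hv₂ 0 (by decide), hn]
  have hfin := eval_upto (x := 18) (y := 0) (σ := σ₂) (P := Bd)
    (Constructing σ c K n) (by
      have h0 : ∀ t : Fin c, (σ₂.setVar 18 0).arr 14 t = 0 := fun t => by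
        simpa using (hinit t t.2).1
      have hcode : (σ₂.setVar 18 0).var 14 =
          enc (σ.var 7) (fun t : Fin c => (σ₂.setVar 18 0).arr 14 t) := by
        simp only [h0]; rw [enc_zero]; simpa using h14
      constructor
      · intro k hk; omega
      · intro t; rw [h0, Finset.sum_filter]; simp
      · intro t; rw [h0]; exact h6
      · exact hcode
      · simpa [h14, h17] using hVc
      · simp [h17]; exact fun t => (hinit t t.2).2
      · intro k hk; omega
      · intro t ht; exact absurd (h0 t) ht
      · intro k hk; omega) (by
      intro i hi τ h18 hv ha h
      rw [hn₂] at hi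
      have hstep := construct_step hp hc hV hx hord hlead hi h18
        (fun z hz => by rw [hv z (by revert z; decide), hv₂ z (by revert z; decide)])
        (fun a hz => by rw [ha a (by revert a; decide), ha₂ a (by revert a; decide)]) h
      rw [← hBd] at hstep
      exact ⟨hstep.core_lt, hstep.level, hstep.level_lt, by simpa using hstep.code,
        by simpa using hstep.value_le, by simpa using hstep.cache_sum, hstep.demand_le,
        hstep.opened, hstep.output⟩)
  rw [hn₂] at hfin
  set σ₃ := (LProg.upto 18 0 Bd).eval σ₂ with hσ₃
  have hA3 : ∀ j, σ₃.arr 3 j ≤ ((write 3 (const 0) (read 3 (const 0) + var 17)).eval σ₃).arr 3 j := by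
    intro j
    by_cases hj : j = 0
    · subst hj; simp
    · simp [Function.update_of_ne hj]
  refine ⟨σ₃.arr 15, hfin.core_lt, fun t => ?_, ?_, fun k hk => (hfin.demand_le k hk).trans (hA3 _),
    fun hc0 => ?_⟩
  · rw [← hfin.level]; exact hfin.level_lt t
  · simpa using hfin.output
  · have := sum_update_fin (c := c) (σ₃.arr 3) ⟨0, hc0⟩ (σ₃.var 17)
    have h1 := hfin.cache_sum
    simp only at this
    simp
    rw [this]; omega

/-! ### Verification of the search -/

/-- Jobs of loads `a` and demands `x` can be scheduled on `c` cores with `K` cache and makespan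
at most `T`. -/
def Solvable (n c K : ℕ) (a x : ℕ → ℕ) (T : ℕ) : Prop :=
  ∃ (s : ℕ → Fin c) (p : Fin c → ℕ), ∑ t, p t = K ∧ (∀ k < n, x k ≤ p (s k)) ∧
    ∀ t, ∑ k ∈ (Finset.range n).filter (fun k => s k = t), a k ≤ T

/-- The cache partition `p` and the job assignment `f` are a solution of makespan little more than
`T` for the jobs of loads `a` and demands `x`, which are named by `ord`. -/
structure NearlySolves (n c K q : ℕ) (ord a x : ℕ → ℕ) (T : ℕ) (p f : ℕ → ℕ) : Prop where
  core_lt : ∀ k < n, f (ord k) < c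
  demand_le : ∀ k < n, x k ≤ p (f (ord k))
  load_le : ∀ t : Fin c, (∑ k ∈ (Finset.range n).filter (fun k => f (ord k) = t), a k) * (q * q) ≤
    (q * q + q * 3 + 3) * T
  cache_sum : 0 < c → ∑ t : Fin c, p t = K

theorem NearlySolves.mono {n c K q T T' : ℕ} {ord a x p f : ℕ → ℕ}
    (h : NearlySolves n c K q ord a x T p f) (hT : T ≤ T') :
    NearlySolves n c K q ord a x T' p f :=
  ⟨h.core_lt, h.demand_le, fun t => (h.load_le t).trans (Nat.mul_le_mul_left _ hT), h.cache_sum⟩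

/-- The load of a core is bounded by its rounded load. -/
theorem IsBundling.load_le {q T n o : ℕ} {a lead w : ℕ → ℕ} (h : IsBundling q T a n lead w o)
    (hT : 0 < T) (g : ℕ → ℕ) (t L : ℕ)
    (hL : ∑ k ∈ (Finset.range n).filter (fun k => g k = t), rounded q T lead w k ≤ L) :
    (∑ k ∈ (Finset.range n).filter (fun k => g (lead k) = t), a k) * (q * q) ≤ L * T := by
  have h1 : ∑ k ∈ (Finset.range n).filter (fun k => g (lead k) = t), a k =
      ∑ l ∈ (Finset.range n).filter (fun l => lead l = l ∧ g l = t), w l := by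
    calc _ = ∑ k ∈ (Finset.range n).filter (fun k => lead k ∈
          (Finset.range n).filter (fun l => lead l = l ∧ g l = t)), a k := by
          refine Finset.sum_congr (Finset.filter_congr fun k hk => ?_) fun _ _ => rfl
          have hk := Finset.mem_range.1 hk
          have := h.lead_le k hk
          simp only [Finset.mem_filter, Finset.mem_range, h.lead_lead k hk, true_and]
          exact ⟨fun e => ⟨by omega, e⟩, fun e => e.2⟩
      _ = ∑ l ∈ (Finset.range n).filter (fun l => lead l = l ∧ g l = t),
          ∑ k ∈ (Finset.range n).filter (fun k => lead k = l), a k := by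
          simp only [Finset.sum_filter (s := Finset.range n) (p := fun k => lead k = _)]
          rw [Finset.sum_comm, Finset.sum_filter]
          exact Finset.sum_congr rfl fun k _ => by rw [Finset.sum_ite_eq]
      _ = _ := Finset.sum_congr rfl fun l hl => (h.weight l (by
          exact Finset.mem_range.1 (Finset.mem_filter.1 hl).1)).symm
  rw [h1]
  refine le_trans ?_ (Nat.mul_le_mul_right T hL)
  rw [Finset.sum_mul, Finset.sum_mul, Finset.sum_filter, Finset.sum_filter]
  refine Finset.sum_le_sum fun k _ => ?_
  by_cases hg : g k = t <;> by_cases hl : lead k = k <;> simp only [hg, hl, and_self, and_true,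
    and_false, if_true, if_false, le_refl, Nat.zero_le, rounded]
  have h2 := Nat.lt_div_mul_add hT (a := w k * q * q)
  rw [add_mul, one_mul, ← mul_assoc]
  exact h2.le

/-- The facts on which one attempt depends. -/
structure Prepared (n c K q : ℕ) (σ : Store) : Prop where
  powers : HasPowers σ
  jobs : σ.var 0 = n
  cores : σ.var 1 = c
  cache : σ.var 2 = K
  precision : σ.var 5 = q
  limit : σ.var 6 = q * q + q * 3 + 4
  antitone : ∀ i j, i ≤ j → j < n → σ.arr 9 j ≤ σ.arr 9 i
  order : ∀ i j, i < n → j < n → σ.arr 7 i = σ.arr 7 j → i = j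
  table : ∀ k, n * σ.var 8 ≤ k → σ.arr 13 k = 0

theorem Prepared.congr {n c K q : ℕ} {σ τ : Store} (h : Prepared n c K q σ)
    (hv : ∀ z ∈ [0, 1, 2, 5, 6, 7, 8], τ.var z = σ.var z)
    (ha : ∀ a ∈ [5, 7, 9], τ.arr a = σ.arr a)
    (hV : ∀ k, n * σ.var 8 ≤ k → τ.arr 13 k = σ.arr 13 k) : Prepared n c K q τ := by
  constructor
  · exact h.powers.congr (fun z hz => hv z (by revert z; decide)) (ha 5 (by decide))
  · rw [hv 0 (by decide), h.jobs]
  · rw [hv 1 (by decide), h.cores]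
  · rw [hv 2 (by decide), h.cache]
  · rw [hv 5 (by decide), h.precision]
  · rw [hv 6 (by decide), h.limit]
  · rw [ha 9 (by decide)]; exact h.antitone
  · rw [ha 7 (by decide)]; exact h.order
  · intro k hk
    rw [hv 8 (by decide)] at hk
    rw [hV k hk, h.table k hk]

theorem attempt_spec {n c K q : ℕ} {σ : Store} (h : Prepared n c K q σ) (hT : 0 < σ.var 12) :
    (∀ k, n * σ.var 8 ≤ k → (attempt.eval σ).arr 13 k = σ.arr 13 k) ∧
    (NearlySolves n c K q (σ.arr 7) (σ.arr 8) (σ.arr 9) (σ.var 12) ((attempt.eval σ).arr 3)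
        ((attempt.eval σ).arr 4) ∨
      ¬ Solvable n c K (σ.arr 8) (σ.arr 9) (σ.var 12) ∧
        (attempt.eval σ).arr 3 = σ.arr 3 ∧ (attempt.eval σ).arr 4 = σ.arr 4) := by
  simp only [attempt, eval_seq]
  have hb := bundle_spec σ
  set σ₁ := bundle.eval σ with hσ₁
  have hv₁ : ∀ z ∈ [0, 1, 2, 5, 6, 7, 8, 12], σ₁.var z = σ.var z := fun z hz => by
    rw [hσ₁, eval_var_of_notMem _ _ _ (by revert z; decide)]
  have ha₁ : ∀ a ∈ [3, 4, 5, 7, 8, 9, 13], σ₁.arr a = σ.arr a := fun a hz => by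
    rw [hσ₁, eval_arr_of_notMem _ _ _ (by revert a; decide)]
  rw [h.jobs, h.precision] at hb
  have hr := round_spec σ₁ (by rw [hv₁ 0 (by decide), h.jobs]; exact hb.lead_le)
  rw [hv₁ 0 (by decide), h.jobs, hv₁ 5 (by decide), h.precision, hv₁ 12 (by decide)] at hr
  set σ₂ := round.eval σ₁ with hσ₂
  have hv₂ : ∀ z ∈ [0, 1, 2, 5, 6, 7, 8, 12], σ₂.var z = σ.var z := fun z hz => by
    rw [hσ₂, eval_var_of_notMem _ _ _ (by revert z; decide), hv₁ z hz]
  have ha₂ : ∀ a ∈ [3, 4, 5, 7, 8, 9, 13], σ₂.arr a = σ.arr a := fun a hz => by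
    rw [hσ₂, eval_arr_of_notMem _ _ _ (by revert a; decide), ha₁ a hz]
  have h10₂ : σ₂.arr 10 = σ₁.arr 10 := by rw [hσ₂, eval_arr_of_notMem _ _ _ (by decide)]
  have hp₂ : Prepared n c K q σ₂ := h.congr (fun z hz => hv₂ z (by revert z; decide))
    (fun a hz => ha₂ a (by revert a; decide)) fun k _ => by rw [ha₂ 13 (by decide)]
  obtain ⟨ht1, ht2⟩ := table_spec hp₂.powers
  set σ₃ := table.eval σ₂ with hσ₃
  have hv₃ : ∀ z ∈ [0, 1, 2, 5, 6, 7, 8, 12], σ₃.var z = σ.var z := fun z hz => by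
    rw [hσ₃, eval_var_of_notMem _ _ _ (by revert z; decide), hv₂ z hz]
  have ha₃' : ∀ a, a ≠ 13 → σ₃.arr a = σ₂.arr a := fun a hz => by
    rw [hσ₃, eval_arr_of_notMem _ _ _ (by simpa [table, entry, modArr] using hz)]
  have ha₃ : ∀ a ∈ [3, 4, 5, 7, 8, 9], σ₃.arr a = σ.arr a := fun a hz => by
    rw [ha₃' a (by revert a; decide), ha₂ a (by revert a; decide)]
  rw [hp₂.jobs, hv₂ 8 (by decide), ha₂ 13 (by decide)] at ht1
  have hp₃ : Prepared n c K q σ₃ := h.congr (fun z hz => hv₃ z (by revert z; decide))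
    (fun a hz => ha₃ a (by revert a; decide)) ht1
  have hV : ∀ i < n, ∀ lev : Fin c → ℕ, (∀ t, lev t < σ₃.var 6) →
      IsEntry (σ₃.var 7) (σ₃.var 6) (σ₃.var 8) K (σ₃.arr 12) (σ₃.arr 9) (σ₃.arr 13) i lev := by
    rw [hp₂.jobs, hp₂.cache, hv₂ 6 (by decide), hv₂ 7 (by decide), hv₂ 8 (by decide)] at ht2
    rw [hv₃ 6 (by decide), hv₃ 7 (by decide), hv₃ 8 (by decide), ha₃' 12 (by decide),
      ha₃' 9 (by decide)]
    have hc := hp₂.cores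
    generalize σ₂.var 1 = c' at ht2 hc
    subst hc
    exact ht2
  have h10₃ : σ₃.arr 10 = σ₁.arr 10 := by rw [ha₃' 10 (by decide), h10₂]
  have h12₃ : ∀ i < n, σ₃.arr 12 i = rounded q (σ.var 12) (σ₁.arr 10) (σ₁.arr 11) i := by
    rw [ha₃' 12 (by decide)]; exact hr
  have hbranch : (ite (var 2 + const 1 - read 13 (var 1)) construct skip).eval σ₃ =
      if σ₃.arr 13 c ≤ K then construct.eval σ₃ else σ₃ := by
    simp only [eval_ite, val_sub, val_add, val_var, val_const, val_read, hp₃.cache, hp₃.cores,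
      eval_skip]
    by_cases hle : σ₃.arr 13 c ≤ K
    · rw [if_pos hle, if_neg (by omega)]
    · rw [if_neg hle, if_pos (by omega)]
  rw [hbranch]
  split_ifs with hle
  · refine ⟨fun k hk => ?_, Or.inl ?_⟩
    · rw [eval_arr_of_notMem _ _ _ (by decide), ht1 k hk]
    · obtain ⟨g, h1, h2, h3, h4, h5⟩ := construct_spec hp₃.powers hp₃.jobs hp₃.cores hp₃.cache hV hle
        (by rw [hp₃.limit]; omega) hp₃.antitone hp₃.order (by rw [h10₃]; exact hb.lead_le)
      rw [ha₃ 7 (by decide), h10₃] at h3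
      rw [ha₃ 9 (by decide)] at h4
      have hll : ∀ k < n, σ₁.arr 10 k < n := fun k hk => (hb.lead_le k hk).trans_lt hk
      refine ⟨fun k hk => ?_, fun k hk => ?_, fun t => ?_, h5⟩
      · rw [h3 k hk]; exact h1 _ (hll k hk)
      · rw [h3 k hk]
        exact (h.antitone _ _ (hb.lead_le k hk) hk).trans (h4 _ (hll k hk))
      · rw [Finset.filter_congr fun k hk => by rw [h3 k (Finset.mem_range.1 hk)]]
        refine hb.load_le hT g t _ ?_
        have h6 := h2 t
        rw [hp₃.limit] at h6
        refine (Finset.sum_congr rfl fun k hk => (h12₃ k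
          (Finset.mem_range.1 (Finset.mem_filter.1 hk).1)).symm).trans_le (Nat.le_of_lt_succ h6)
  · refine ⟨ht1, Or.inr ⟨?_, ha₃ 3 (by decide), ha₃ 4 (by decide)⟩⟩
    rintro ⟨s, p, hpK, hx, hload⟩
    refine hle ?_
    obtain ⟨g, hg1, hg2⟩ := hb.exists_placement hT s p h.antitone hx hload
    have hlev : ∀ i ≤ n, levels (σ₃.arr 12) g i =
        levels (rounded q (σ.var 12) (σ₁.arr 10) (σ₁.arr 11)) g i := fun i hi => by
      funext t
      refine Finset.sum_congr rfl fun k hk => h12₃ k ?_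
      have := Finset.mem_range.1 (Finset.mem_filter.1 hk).1; omega
    rw [← hpK]
    refine table_le hV (fun lev _ => ?_) g p ?_ ?_
    · exact hp₃.table _ (Nat.le_add_right _ _)
    · rw [hlev n le_rfl, hp₃.limit]; exact hg1
    · intro i hi
      rw [hlev i hi.le, h12₃ i hi, ha₃ 9 (by decide)]
      exact hg2 i hi

theorem search_loop_spec {n c K q : ℕ} {σ : Store} (h : Prepared n c K q σ) (hM : 0 < σ.var 11)
    (h12 : σ.var 12 = σ.var 11 * σ.var 9) :
    ∀ k, 0 < k → k ≤ σ.var 9 → Solvable n c K (σ.arr 8) (σ.arr 9) (σ.var 11 * k) →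
      NearlySolves n c K q (σ.arr 7) (σ.arr 8) (σ.arr 9) (σ.var 11 * k)
        (((LProg.upto 20 9 (attempt ;; assign 12 (var 12 - var 11))).eval σ).arr 3)
        (((LProg.upto 20 9 (attempt ;; assign 12 (var 12 - var 11))).eval σ).arr 4) := by
  have key := eval_upto (x := 20) (y := 9) (σ := σ) (P := attempt ;; assign 12 (var 12 - var 11))
    (fun i τ => τ.var 12 = σ.var 11 * (σ.var 9 - i) ∧
      (∀ k, n * σ.var 8 ≤ k → τ.arr 13 k = σ.arr 13 k) ∧
      ∀ k, σ.var 9 < k + i → k ≤ σ.var 9 →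
        Solvable n c K (σ.arr 8) (σ.arr 9) (σ.var 11 * k) →
        NearlySolves n c K q (σ.arr 7) (σ.arr 8) (σ.arr 9) (σ.var 11 * k) (τ.arr 3) (τ.arr 4))
    ⟨by simpa using h12, by simp, fun k _ _ => by omega⟩ (by
    rintro i hi τ h20 hv ha ⟨h1, h2, h3⟩
    have hpτ : Prepared n c K q τ := h.congr (fun z hz => hv z (by revert z; decide))
      (fun a hz => ha a (by revert a; decide)) h2
    have e11 : τ.var 11 = σ.var 11 := hv 11 (by decide)
    have hpos : 0 < τ.var 12 := by
      rw [h1]; exact Nat.mul_pos hM (by omega)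
    obtain ⟨h4, h5⟩ := attempt_spec hpτ hpos
    rw [ha 7 (by decide), ha 8 (by decide), ha 9 (by decide), h1] at h5
    rw [hv 8 (by decide)] at h4
    have f11 : (attempt.eval τ).var 11 = σ.var 11 := by
      rw [eval_var_of_notMem _ _ _ (by decide), e11]
    have f12 : (attempt.eval τ).var 12 = σ.var 11 * (σ.var 9 - i) := by
      rw [eval_var_of_notMem _ _ _ (by decide), h1]
    refine ⟨?_, fun k hk => ?_, fun k hk hk9 hsol => ?_⟩
    · simp only [eval_seq, eval_assign, val_sub, val_var, Store.setVar_var, f11, f12]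
      simp only [Nat.reduceEqDiff, if_true, if_false]
      rw [show σ.var 9 - i = σ.var 9 - (i + 1) + 1 by omega, mul_add, mul_one, Nat.add_sub_cancel]
    · simp only [eval_seq, eval_assign, Store.setVar_arr]
      rw [h4 k hk, h2 k hk]
    · simp only [eval_seq, eval_assign, Store.setVar_arr]
      rcases h5 with h5 | ⟨h5, h6, h7⟩
      · exact h5.mono (Nat.mul_le_mul_left _ (by omega))
      · rw [h6, h7]
        rcases eq_or_ne k (σ.var 9 - i) with rfl | hne
        · exact absurd hsol h5
        · exact h3 k (by omega) hk9 hsol)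
  exact fun k hk => key.2.2 k (by omega)

/-! ### The approximation guarantee -/

theorem sum_rank {n : ℕ} (x : ℕ → ℕ) (F : ℕ → ℕ) :
    ∑ k ∈ Finset.range n, F k = ∑ j : Fin n, F (rank n x j) := by
  rw [Finset.sum_range, ← Equiv.sum_comp (rankEquiv n x)]
  rfl

/-- What the search achieves, in terms of the jobs. -/
theorem search_spec {q : ℕ} {σ : Store} (hp : HasPowers σ) (h5 : σ.var 5 = q)
    (h6 : σ.var 6 = q * q + q * 3 + 4) (h13 : ∀ k, σ.arr 13 k = 0) :
    ∃ (M : ℕ) (ord a x : ℕ → ℕ), 0 < M ∧ (∀ j < σ.var 0, intLoad σ j ≤ M) ∧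
      (M = 1 ∨ ∃ j < σ.var 0, M = intLoad σ j) ∧
      (∀ j < σ.var 0, ord (rank (σ.var 0) (σ.arr 2) j) = j ∧
        a (rank (σ.var 0) (σ.arr 2) j) = intLoad σ j * q ∧
        x (rank (σ.var 0) (σ.arr 2) j) = σ.arr 2 j) ∧
      ∀ k, 0 < k → k ≤ σ.var 9 → Solvable (σ.var 0) (σ.var 1) (σ.var 2) a x (M * k) →
        NearlySolves (σ.var 0) (σ.var 1) (σ.var 2) q ord a x (M * k) ((search.eval σ).arr 3)
          ((search.eval σ).arr 4) := by
  obtain ⟨hl1, hl2, hl3, hl4⟩ := loads_spec σ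
  set σ₁ := loads.eval σ with hσ₁
  have hv₁ : ∀ z ∈ [0, 1, 2, 5, 6, 7, 8, 9], σ₁.var z = σ.var z := fun z hz => by
    rw [hσ₁, eval_var_of_notMem _ _ _ (by revert z; decide)]
  have ha₁ : ∀ a ∈ [2, 5, 13], σ₁.arr a = σ.arr a := fun a hz => by
    rw [hσ₁, eval_arr_of_notMem _ _ _ (by revert a; decide)]
  have ho := order_spec σ₁
  rw [hv₁ 0 (by decide), ha₁ 2 (by decide)] at ho
  set σ₂ := order.eval σ₁ with hσ₂
  have hv₂ : ∀ z ∈ [0, 1, 2, 5, 6, 7, 8, 9, 11], σ₂.var z = σ₁.var z := fun z hz => by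
    rw [hσ₂, eval_var_of_notMem _ _ _ (by revert z; decide)]
  have ha₂ : ∀ a ∈ [2, 5, 13], σ₂.arr a = σ.arr a := fun a hz => by
    rw [hσ₂, eval_arr_of_notMem _ _ _ (by revert a; decide), ha₁ a hz]
  set σ₃ := (assign 12 (var 11 * var 9)).eval σ₂ with hσ₃
  have hv₃ : ∀ z ∈ [0, 1, 2, 5, 6, 7, 8, 9], σ₃.var z = σ.var z := fun z hz => by
    rw [hσ₃, eval_var_of_notMem _ _ _ (by revert z; decide), hv₂ z (by revert z; decide), hv₁ z hz]
  have ha₃ : σ₃.arr = σ₂.arr := rfl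
  have e11 : σ₃.var 11 = σ₁.var 11 := by
    rw [hσ₃, eval_var_of_notMem _ _ _ (by decide), hv₂ 11 (by decide)]
  have hj : ∀ k < σ.var 0, ∃ j < σ.var 0, rank (σ.var 0) (σ.arr 2) j = k := fun k hk => by
    obtain ⟨j, hj⟩ := (rankEquiv (σ.var 0) (σ.arr 2)).surjective ⟨k, hk⟩
    exact ⟨j, j.2, congrArg Fin.val hj⟩
  have hprep : Prepared (σ.var 0) (σ.var 1) (σ.var 2) q σ₃ := by
    constructor
    · exact hp.congr (fun z hz => hv₃ z (by revert z; decide)) (by rw [ha₃, ha₂ 5 (by decide)])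
    · exact hv₃ 0 (by decide)
    · exact hv₃ 1 (by decide)
    · exact hv₃ 2 (by decide)
    · rw [hv₃ 5 (by decide), h5]
    · rw [hv₃ 6 (by decide), h6]
    · intro i k hik hk
      obtain ⟨i', hi', rfl⟩ := hj i (by omega)
      obtain ⟨k', hk', rfl⟩ := hj k hk
      rw [ha₃, (ho i' hi').2.2, (ho k' hk').2.2]
      exact demand_antitone _ hi' hk' hik
    · intro i k hi hk he
      obtain ⟨i', hi', rfl⟩ := hj i hi
      obtain ⟨k', hk', rfl⟩ := hj k hk
      rw [ha₃, (ho i' hi').1, (ho k' hk').1] at he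
      rw [he]
    · intro k _
      rw [ha₃, ha₂ 13 (by decide), h13]
  have hfin := search_loop_spec hprep (by rw [e11]; exact hl2) (by
    rw [e11, hv₃ 9 (by decide), hσ₃]
    simp [hv₂ 11 (by decide), hv₂ 9 (by decide), hv₁ 9 (by decide)])
  rw [e11, hv₃ 9 (by decide), ha₃] at hfin
  exact ⟨σ₁.var 11, σ₂.arr 7, σ₂.arr 8, σ₂.arr 9, hl2, hl3, hl4, fun j hj => ⟨(ho j hj).1, by
    rw [(ho j hj).2.1, hl1 j hj, h5], (ho j hj).2.2⟩, hfin⟩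

/-- The arithmetic of the approximation ratio. -/
theorem ratio_le {q S M O : ℕ} (hq : 0 < q) (hMO : M ≤ O)
    (h : S * q * (q * q) ≤ (q * q + q * 3 + 3) * (M * (O * q / M + 1))) :
    S * q ≤ (q + 13) * O := by
  have h1 : M * (O * q / M + 1) ≤ (q + 1) * O := by
    have := Nat.mul_div_le (O * q) M
    nlinarith
  have h2 : S * q * (q * q) ≤ (q + 13) * O * (q * q) := by
    refine h.trans ((Nat.mul_le_mul_left _ h1).trans ?_)
    have h3 : (q * q + q * 3 + 3) * (q + 1) ≤ (q + 13) * (q * q) := by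
      have : q ≤ q * q := Nat.le_mul_self q
      nlinarith
    calc _ = (q * q + q * 3 + 3) * (q + 1) * O := by ring
      _ ≤ (q + 13) * (q * q) * O := Nat.mul_le_mul_right _ h3
      _ = _ := by ring
  exact Nat.le_of_mul_le_mul_right h2 (Nat.mul_pos hq hq)

/-- The loads after multiplication with the common denominator `D`, as natural numbers. -/
theorem exists_intLoad (I : Inst) {σ : Store} (h0 : σ.var 0 = I.n)
    (hnum : ∀ j : Fin I.n, σ.arr 0 j = (I.load j).num)
    (hden : ∀ j : Fin I.n, σ.arr 1 j = (I.load j).den) :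
    0 < denom σ ∧ ∀ j : Fin I.n, (intLoad σ j : ℚ≥0) = denom σ * I.load j := by
  refine ⟨Finset.prod_pos fun j hj => ?_, fun j => ?_⟩
  · have hj' : j < I.n := by rw [← h0]; exact Finset.mem_range.1 hj
    rw [hden ⟨j, hj'⟩]; exact (I.load _).den_pos
  · have hdvd : (I.load j).den ∣ denom σ := by
      rw [← hden j]
      exact Finset.dvd_prod_of_mem (σ.arr 1) (by rw [h0]; simp)
    obtain ⟨m, hm⟩ := hdvd
    rw [intLoad, hden, hnum, hm, Nat.mul_div_cancel_left _ (I.load j).den_pos]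
    push_cast
    rw [← NNRat.mul_den_eq_num]; ring

theorem sum_intLoad {I : Inst} (s : Sol I) {A : ℕ → ℕ} {D : ℕ}
    (hA : ∀ j : Fin I.n, (A j : ℚ≥0) = D * I.load j) (t : Fin I.c) :
    ((∑ j with s.core j = t, A j : ℕ) : ℚ≥0) = D * ∑ j with s.core j = t, I.load j := by
  push_cast
  rw [Finset.mul_sum]
  exact Finset.sum_congr rfl fun j _ => hA j

/-- The search finds a solution that is nearly as good as a given one. -/
theorem search_correct (I : Inst) {q : ℕ} (hq : 0 < q) {σ : Store} (hp : HasPowers σ)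
    (h0 : σ.var 0 = I.n) (h1 : σ.var 1 = I.c) (h2 : σ.var 2 = I.K) (h5 : σ.var 5 = q)
    (h6 : σ.var 6 = q * q + q * 3 + 4) (h9 : σ.var 9 = I.n * q + 1) (h13 : ∀ k, σ.arr 13 k = 0)
    (hnum : ∀ j : Fin I.n, σ.arr 0 j = (I.load j).num)
    (hden : ∀ j : Fin I.n, σ.arr 1 j = (I.load j).den)
    (hdem : ∀ j : Fin I.n, σ.arr 2 j = I.demand j) (s' : Sol I) :
    ∃ s : Sol I, s.IsOutput (search.eval σ) ∧
      ∀ t : Fin I.c, (∑ j with s.core j = t, I.load j) * q ≤ (q + 13) * s'.makespan := by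
  rcases Nat.eq_zero_or_pos I.c with hc | hc
  · refine ⟨s', ⟨fun i => absurd i.2 (by omega), fun j => absurd (s'.core j).2 (by omega)⟩,
      fun t => absurd t.2 (by omega)⟩
  obtain ⟨M, ord, a, x, hM, hAM, hM1, hrank, hsol⟩ := search_spec hp h5 h6 h13
  obtain ⟨hD, hA⟩ := exists_intLoad I h0 hnum hden
  generalize denom σ = D at hD hA
  generalize intLoad σ = A at hAM hM1 hrank hA
  rw [h0] at hAM hM1 hrank
  rw [h0, h1, h2, h9] at hsol
  set R := rank I.n (σ.arr 2) with hR
  generalize search.eval σ = τ at hsol ⊢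
  have hAO : ∀ t, ∑ j with s'.core j = t, A j ≤ min ⌊(D : ℚ≥0) * s'.makespan⌋₊ (I.n * M) := by
    intro t
    refine le_min (Nat.le_floor ?_) ?_
    · rw [sum_intLoad s' hA]
      gcongr
      exact Finset.le_sup (f := fun i : Fin I.c => ∑ j with s'.core j = i, I.load j)
        (Finset.mem_univ t)
    · calc ∑ j with s'.core j = t, A j ≤ ∑ j : Fin I.n, A j :=
            Finset.sum_le_sum_of_subset (Finset.filter_subset _ _)
        _ ≤ ∑ _j : Fin I.n, M := Finset.sum_le_sum fun j _ => hAM j j.2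
        _ = I.n * M := by simp
  set O := min ⌊(D : ℚ≥0) * s'.makespan⌋₊ (I.n * M) with hO
  have hOle : (O : ℚ≥0) ≤ D * s'.makespan :=
    le_trans (by exact_mod_cast min_le_left _ _) (Nat.floor_le (by positivity))
  have hOn : O * q / M ≤ I.n * q := by
    refine Nat.div_le_of_le_mul ?_
    calc O * q ≤ I.n * M * q := Nat.mul_le_mul_right _ (min_le_right _ _)
      _ = M * (I.n * q) := by ring
  have hOT : O * q ≤ M * (O * q / M + 1) := by
    have := Nat.lt_mul_div_succ (O * q) hM
    exact this.le
  set s₀ : ℕ → Fin I.c := fun k =>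
    if hk : k < I.n then s'.core ((rankEquiv I.n (σ.arr 2)).symm ⟨k, hk⟩) else ⟨0, hc⟩ with hs₀
  have hs₀R : ∀ j : Fin I.n, s₀ (R j) = s'.core j := by
    intro j
    have hlt : R j < I.n := rank_lt _ j.2
    have : (rankEquiv I.n (σ.arr 2)).symm ⟨R j, hlt⟩ = j := by
      rw [Equiv.symm_apply_eq]; rfl
    simp only [hs₀, hlt, dif_pos, this]
  have hsurj : ∀ k < I.n, ∃ j : Fin I.n, R j = k := fun k hk => by
    obtain ⟨j, hj⟩ := (rankEquiv I.n (σ.arr 2)).surjective ⟨k, hk⟩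
    exact ⟨j, congrArg Fin.val hj⟩
  have hnear := hsol (O * q / M + 1) (Nat.succ_pos _) (Nat.succ_le_succ hOn) ⟨s₀, s'.cache, s'.cache_sum, by
      intro k hk
      obtain ⟨j, rfl⟩ := hsurj k hk
      rw [hs₀R, (hrank j j.2).2.2, hdem]
      exact s'.demand_le j, by
      intro t
      refine le_trans ?_ hOT
      rw [Finset.sum_filter, sum_rank (σ.arr 2), ← hR]
      refine le_trans (le_of_eq ?_) (Nat.mul_le_mul_right q (hAO t))
      rw [Finset.sum_mul, Finset.sum_filter]
      exact Finset.sum_congr rfl fun j _ => by rw [hs₀R, (hrank j j.2).2.1]⟩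
  have hcore : ∀ j : Fin I.n, τ.arr 4 j < I.c := fun j => by
    have := hnear.core_lt (R j) (rank_lt _ j.2)
    rwa [(hrank j j.2).1] at this
  refine ⟨⟨fun i => τ.arr 3 i, fun j => ⟨τ.arr 4 j, hcore j⟩, hnear.cache_sum hc, fun j => ?_⟩,
    ⟨fun i => rfl, fun j => rfl⟩, fun t => ?_⟩
  · have := hnear.demand_le (R j) (rank_lt _ j.2)
    rwa [(hrank j j.2).1, (hrank j j.2).2.2, hdem] at this
  · set s : Sol I := ⟨fun i => τ.arr 3 i, fun j => ⟨τ.arr 4 j, hcore j⟩, hnear.cache_sum hc, fun j => by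
      have := hnear.demand_le (R j) (rank_lt _ j.2)
      rwa [(hrank j j.2).1, (hrank j j.2).2.2, hdem] at this⟩ with hs
    have hS : (∑ j with s.core j = t, A j) * q ≤ (q + 13) * O := by
      by_cases hMO : M ≤ O
      · refine ratio_le hq hMO (le_trans (le_of_eq ?_) (hnear.load_le t))
        congr 1
        rw [Finset.sum_filter (s := Finset.range I.n), sum_rank (σ.arr 2), ← hR, Finset.sum_mul,
          Finset.sum_filter]
        refine Finset.sum_congr rfl fun j _ => ?_
        rw [(hrank j j.2).1, (hrank j j.2).2.1]
        simp only [hs, Fin.ext_iff]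
      · have hle : ∀ j : Fin I.n, A j ≤ O := fun j =>
          (Finset.single_le_sum (f := fun j : Fin I.n => A j) (fun _ _ => Nat.zero_le _)
            (by simp)).trans (hAO (s'.core j))
        have hO0 : O = 0 := by
          rcases hM1 with h | ⟨j, hj, h⟩
          · omega
          · exact absurd (hle ⟨j, hj⟩) (by simp only; omega)
        rw [Finset.sum_eq_zero fun j _ => by have := hle j; omega, zero_mul]
        exact Nat.zero_le _
    have hS' : ((∑ j with s.core j = t, A j : ℕ) : ℚ≥0) * q ≤ (q + 13) * O := by exact_mod_cast hS
    rw [sum_intLoad s hA] at hS'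
    have hD' : (0 : ℚ≥0) < D := by exact_mod_cast hD
    refine le_of_mul_le_mul_left ?_ hD'
    calc _ = D * (∑ j with s.core j = t, I.load j) * q := by ring
      _ ≤ (q + 13) * O := hS'
      _ ≤ (q + 13) * (D * s'.makespan) := by gcongr
      _ = _ := by ring

/-! ### The running time -/

/-- The whole program. -/
def program : LProg := precision ;; limits ;; powers ;; search

/-- The memories between the parts of the program. -/
theorem exists_memories (I : Inst) (ε : ℚ≥0) {q L : ℕ}
    (hq : q = (ε.den / ε.num + 1) * 13) (hL : L = q * q + q * 3 + 4) :
    ∃ σ₁ σ₂ σ₃ : Store, precision.eval (I.input ε) = σ₁ ∧ limits.eval σ₁ = σ₂ ∧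
      powers.eval σ₂ = σ₃ ∧
      (∀ z ∈ [0, 1, 2, 3, 4], σ₁.var z = (I.input ε).var z ∧ σ₂.var z = (I.input ε).var z ∧
        σ₃.var z = (I.input ε).var z) ∧
      σ₁.var 5 = q ∧ σ₁.var 7 = I.c + 1 ∧
      σ₂.var 5 = q ∧ σ₂.var 6 = L ∧ σ₂.var 7 = I.c + 1 ∧ σ₂.var 9 = I.n * q + 1 ∧
      σ₃.var 5 = q ∧ σ₃.var 6 = L ∧ σ₃.var 9 = I.n * q + 1 ∧
      σ₃.var 7 = I.c + 1 ∧ σ₃.var 8 = (I.c + 1) ^ L ∧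
      (∀ a ≠ 5, σ₃.arr a = (I.input ε).arr a) ∧
      (∀ l < L, σ₃.arr 5 l = (I.c + 1) ^ l) ∧ ∀ l, L ≤ l → σ₃.arr 5 l = 0 := by
  set σ₁ := precision.eval (I.input ε) with hσ₁
  set σ₂ := limits.eval σ₁ with hσ₂
  set σ₃ := powers.eval σ₂ with hσ₃
  have hv₁ : ∀ z, z ∉ [5, 7] → σ₁.var z = (I.input ε).var z := fun z hz => by
    rw [hσ₁, eval_var_of_notMem _ _ _ (by simpa [precision, modVar] using hz)]
  have hv₂ : ∀ z, z ∉ [6, 9] → σ₂.var z = σ₁.var z := fun z hz => by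
    rw [hσ₂, eval_var_of_notMem _ _ _ (by simpa [limits, modVar] using hz)]
  have hv₃ : ∀ z, z ∉ [8, 18] → σ₃.var z = σ₂.var z := fun z hz => by
    rw [hσ₃, eval_var_of_notMem _ _ _ (by simp [powers, modVar]; simp at hz; tauto)]
  have h5 : σ₁.var 5 = q := by rw [hσ₁, precision_var_five, hq]; rfl
  have h7 : σ₁.var 7 = I.c + 1 := by rw [hσ₁, precision_var_seven]; rfl
  have h6 : σ₂.var 6 = L := by rw [hσ₂, limits_var_six, h5, hL]
  have h9 : σ₂.var 9 = I.n * q + 1 := by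
    rw [hσ₂, limits_var_nine, h5, hv₁ 0 (by decide)]; rfl
  have h72 : σ₂.var 7 = I.c + 1 := by rw [hv₂ 7 (by decide), h7]
  have h52 : σ₂.var 5 = q := by rw [hv₂ 5 (by decide), h5]
  have ha₂ : ∀ a, σ₂.arr a = (I.input ε).arr a := fun a => by
    rw [hσ₂, eval_arr_of_notMem _ _ _ (by simp [limits, modArr]), hσ₁,
      eval_arr_of_notMem _ _ _ (by simp [precision, modArr])]
  obtain ⟨hp1, hp2, hp3⟩ := powers_spec σ₂
  rw [h6, h72] at hp1 hp2
  rw [h6, ha₂] at hp3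
  refine ⟨σ₁, σ₂, σ₃, rfl, rfl, rfl, fun z hz => ?_, h5, h7, h52, h6, h72, h9, ?_, ?_, ?_, ?_, hp1,
    fun a ha => ?_, hp2, fun l hl => ?_⟩
  · have e1 := hv₁ z (by revert z; decide)
    have e2 := hv₂ z (by clear e1; revert z; decide)
    have e3 := hv₃ z (by clear e1 e2; revert z; decide)
    exact ⟨e1, by rw [e2, e1], by rw [e3, e2, e1]⟩
  · rw [hv₃ 5 (by decide), h52]
  · rw [hv₃ 6 (by decide), h6]
  · rw [hv₃ 9 (by decide), h9]
  · rw [hv₃ 7 (by decide), h72]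
  · rw [hσ₃, eval_arr_of_notMem _ _ _ (by simpa [powers, modArr] using ha), ha₂]
  · rw [hp3 l hl]; simp [Inst.input]

theorem input_sized (I : Inst) (ε : ℚ≥0) :
    (I.input ε).Sized (I.size + ε.num.size + ε.den.size) := by
  have hj : ∀ j : Fin I.n, (I.load j).num.size + (I.load j).den.size + (I.demand j).size ≤
      I.size := fun j => by
    refine le_trans (Finset.single_le_sum
      (f := fun j => (I.load j).num.size + (I.load j).den.size + (I.demand j).size)
      (fun _ _ => Nat.zero_le _) (Finset.mem_univ j)) ?_
    exact Nat.le_add_left _ _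
  have h0 : I.n + I.c + I.K.size ≤ I.size := Nat.le_add_right _ _
  have h1 := size_le_self I.n
  have h2 := size_le_self I.c
  refine ⟨fun x => ?_, fun a i => ?_⟩
  · simp only [Inst.input]
    split <;> first | omega | simp
  · simp only [Inst.input]
    split_ifs with h
    · have := hj ⟨i, h⟩
      split <;> first | omega | simp
    · simp

/-- The program runs in polynomial time. -/
theorem program_time (ε : ℚ≥0) : ∃ r : Polynomial ℕ, ∀ I : Inst, ∃ t,
    Exec program.compile (I.input ε) t (program.eval (I.input ε)) ∧ t ≤ r.eval I.size := by
  obtain ⟨q, hq⟩ : ∃ q, q = (ε.den / ε.num + 1) * 13 := ⟨_, rfl⟩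
  obtain ⟨L, hL⟩ : ∃ L, L = q * q + q * 3 + 4 := ⟨_, rfl⟩
  obtain ⟨w, hw⟩ := program.exists_polynomial_work
  let X : Polynomial ℕ := Polynomial.X
  let m : Polynomial ℕ := X + Polynomial.C q + Polynomial.C L + (X + 1) ^ L + (X * Polynomial.C q + 1)
  let s : Polynomial ℕ := X + Polynomial.C (ε.num.size + ε.den.size)
  let k : Polynomial ℕ := w.comp m
  refine ⟨k * (s + k * (m + s + 1) + 1), fun I => ?_⟩
  set M := I.size + q + L + (I.size + 1) ^ L + (I.size * q + 1) with hM
  have hm : m.eval I.size = M := by simp [m, X, hM]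
  set S := I.size + ε.num.size + ε.den.size with hS
  have hs : s.eval I.size = S := by simp [s, X, hS, add_assoc]
  have hk : k.eval I.size = program.work M := by simp only [k, Polynomial.eval_comp, hm, hw]
  simp only [Polynomial.eval_mul, Polynomial.eval_add, Polynomial.eval_one, hm, hs, hk]
  obtain ⟨σ₁, σ₂, σ₃, e1, e2, e3, hv, h15, h17, h25, h26, h27, h29, h35, h36, h39, h37, h38,
    ha, hp, hp0⟩ := exists_memories I ε hq hL
  have hin := input_sized I ε
  have hnc : I.n + I.c ≤ I.size := by unfold Inst.size; omega
  have hW : (I.c + 1) ^ L ≤ (I.size + 1) ^ L := Nat.pow_le_pow_left (by omega) _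
  have hNQ : I.n * q ≤ I.size * q := Nat.mul_le_mul_right _ (by omega)
  have hz : ∀ v, v ≤ M + S → v.size ≤ M + S := fun v h => (size_le_self v).trans h
  have hinb : ∀ z, ((I.input ε).var z).size ≤ M + S := fun z => (hin.1 z).trans (by omega)
  have hpos : 1 ≤ (I.size + 1) ^ L := Nat.one_le_pow _ _ (by omega)
  have st0 : (I.input ε).Static [0, 1, 2, 3, 4] [] [] (M + S) M :=
    ⟨⟨fun z _ => hinb z, by simp⟩, by simp⟩
  have st1 : σ₁.Static [0, 1, 2, 3, 4, 5, 7] [] [] (M + S) M := by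
    refine ⟨⟨fun z hz' => ?_, by simp⟩, by simp⟩
    have : z ∈ [0, 1, 2, 3, 4] ∨ z = 5 ∨ z = 7 := by simp at hz' ⊢; tauto
    rcases this with h | rfl | rfl
    · rw [(hv z h).1]; exact hinb z
    · rw [h15]; exact hz _ (by omega)
    · rw [h17]; exact hz _ (by omega)
  have st2 : σ₂.Static [0, 1, 2, 3, 4, 5, 6, 7, 9] [] [6] (M + S) M := by
    refine ⟨⟨fun z hz' => ?_, by simp⟩, ?_⟩
    · have : z ∈ [0, 1, 2, 3, 4] ∨ z = 5 ∨ z = 6 ∨ z = 7 ∨ z = 9 := by simp at hz' ⊢; tauto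
      rcases this with h | rfl | rfl | rfl | rfl
      · rw [(hv z h).2.1]; exact hinb z
      · rw [h25]; exact hz _ (by omega)
      · rw [h26]; exact hz _ (by omega)
      · rw [h27]; exact hz _ (by omega)
      · rw [h29]; exact hz _ (by omega)
    · simp only [List.mem_singleton, forall_eq, h26]; omega
  have h30 : σ₃.var 0 = I.n := (hv 0 (by decide)).2.2
  have h31 : σ₃.var 1 = I.c := (hv 1 (by decide)).2.2
  have st3 : σ₃.Static [0, 1, 2, 5, 6, 7, 8, 9] [0, 1, 2, 5] [0, 1, 6, 8, 9] (M + S) M := by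
    refine ⟨⟨fun z hz' => ?_, fun a _ i => ?_⟩, ?_⟩
    · have : z ∈ [0, 1, 2, 3, 4] ∨ z = 5 ∨ z = 6 ∨ z = 7 ∨ z = 8 ∨ z = 9 := by
        simp at hz' ⊢; tauto
      rcases this with h | rfl | rfl | rfl | rfl | rfl
      · rw [(hv z h).2.2]; exact hinb z
      · rw [h35]; exact hz _ (by omega)
      · rw [h36]; exact hz _ (by omega)
      · rw [h37]; exact hz _ (by omega)
      · rw [h38]; exact hz _ (by omega)
      · rw [h39]; exact hz _ (by omega)
    · by_cases ha5 : a = 5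
      · subst ha5
        rcases lt_or_ge i L with h | h
        · rw [hp i h]
          have : (I.c + 1) ^ i ≤ (I.c + 1) ^ L := Nat.pow_le_pow_right (by omega) h.le
          exact hz _ (by omega)
        · rw [hp0 i h]; simp
      · rw [ha a ha5]; exact (hin.2 a i).trans (by omega)
    · simp only [List.mem_cons, List.not_mem_nil, or_false, forall_eq_or_imp, forall_eq, h30, h31,
        h36, h38, h39]
      exact ⟨by omega, by omega, by omega, by omega, by omega⟩
  have r1 := precision.runsWithin precision_ok _ _ hin st0
  rw [e1] at r1
  obtain ⟨_, _, _, s1⟩ := id r1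
  have r2 := limits.runsWithin limits_ok _ _ s1 st1
  rw [e2] at r2
  obtain ⟨_, _, _, s2⟩ := id r2
  have r3 := powers.runsWithin powers_ok _ _ s2 st2
  rw [e3] at r3
  obtain ⟨_, _, _, s3⟩ := id r3
  have r4 := search.runsWithin search_ok _ _ s3 st3
  have r34 := r3.seq r4
  have r234 := r2.seq r34
  obtain ⟨t, ht, hle, -⟩ := r1.seq r234
  refine ⟨t, ?_, ?_⟩
  · simpa only [program, LProg.compile, eval_seq, e1, e2, e3] using ht
  · exact hle

theorem program_correct (I : Inst) {ε : ℚ≥0} (hε : 0 < ε) (s' : Sol I) :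
    ∃ s : Sol I, s.IsOutput (program.eval (I.input ε)) ∧
      s.makespan ≤ (1 + ε) * s'.makespan := by
  obtain ⟨q, hq⟩ : ∃ q, q = (ε.den / ε.num + 1) * 13 := ⟨_, rfl⟩
  obtain ⟨L, hL⟩ : ∃ L, L = q * q + q * 3 + 4 := ⟨_, rfl⟩
  obtain ⟨σ₁, σ₂, σ₃, e1, e2, e3, hv, h15, h17, h25, h26, h27, h29, h35, h36, h39, h37, h38,
    ha, hp, hp0⟩ := exists_memories I ε hq hL
  have hq0 : 0 < q := by rw [hq]; positivity
  obtain ⟨s, hs, hle⟩ := search_correct I hq0 (σ := σ₃)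
    ⟨by rw [h37, (hv 1 (by decide)).2.2]; rfl, by rw [h38, h37, h36], by rw [h36, h37]; exact hp⟩
    (hv 0 (by decide)).2.2 (hv 1 (by decide)).2.2 (hv 2 (by decide)).2.2 h35 (by rw [h36, hL]) h39
    (fun k => by rw [ha 13 (by decide)]; simp [Inst.input])
    (fun j => by rw [ha 0 (by decide)]; simp [Inst.input])
    (fun j => by rw [ha 1 (by decide)]; simp [Inst.input])
    (fun j => by rw [ha 2 (by decide)]; simp [Inst.input]) s'
  refine ⟨s, by simpa only [program, eval_seq, e1, e2, e3] using hs, Finset.sup_le fun t _ => ?_⟩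
  have hq0' : (0 : ℚ≥0) < q := by exact_mod_cast hq0
  have h13 : (13 : ℚ≥0) ≤ ε * q := by
    have hnum : 0 < ε.num := NNRat.num_pos.2 hε
    have h1 : 13 * ε.den ≤ ε.num * q := by
      have := Nat.lt_mul_div_succ ε.den hnum
      rw [hq, ← mul_assoc, mul_comm 13]
      exact Nat.mul_le_mul_right _ this.le
    have h2 : (13 : ℚ≥0) * ε.den ≤ ε.num * q := by exact_mod_cast h1
    have hden : (0 : ℚ≥0) < ε.den := by exact_mod_cast ε.den_pos
    refine le_of_mul_le_mul_right ?_ hden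
    calc _ ≤ (ε.num : ℚ≥0) * q := h2
      _ = ε * q * ε.den := by rw [← NNRat.mul_den_eq_num]; ring
  refine le_of_mul_le_mul_right ((hle t).trans ?_) hq0'
  calc (q + 13 : ℚ≥0) * s'.makespan ≤ (q + ε * q) * s'.makespan := by gcongr
    _ = _ := by ring

theorem isOutput_unique {I : Inst} {s s' : Sol I} {σ : Store} (h : s.IsOutput σ)
    (h' : s'.IsOutput σ) : s = s' := by
  have h1 : s.cache = s'.cache := funext fun i => (h.1 i).symm.trans (h'.1 i)
  have h2 : s.core = s'.core := funext fun j => Fin.ext ((h.2 j).symm.trans (h'.2 j))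
  cases s; cases s'
  simp only at h1 h2
  subst h1 h2
  rfl

end PTAS

end CacheSched

/-- One program `A` which takes an instance and an accuracy `ε` and, for each fixed `ε > 0`, runs
on correlative instances in time polynomial in the size of the instance and finds a solution
whose makespan is at most `1 + ε` times that of any other solution (if there is a solution). -/
theorem mainTheorem7 :
    ∃ A : CacheSched.Prog, ∀ ε : ℚ≥0, 0 < ε →
      ∃ q : Polynomial ℕ, ∀ I : CacheSched.Inst, I.Correlative →
        ∃ (t : ℕ) (σ : CacheSched.Store),
          CacheSched.Exec A (I.input ε) t σ ∧
          t ≤ q.eval I.size ∧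
          (Nonempty (CacheSched.Sol I) →
            ∃ s : CacheSched.Sol I, s.IsOutput σ ∧
              ∀ s' : CacheSched.Sol I, s.makespan ≤ (1 + ε) * s'.makespan) := by
  refine ⟨CacheSched.PTAS.program.compile, fun ε hε => ?_⟩
  obtain ⟨q, hq⟩ := CacheSched.PTAS.program_time ε
  refine ⟨q, fun I _ => ?_⟩
  obtain ⟨t, ht, hle⟩ := hq I
  refine ⟨t, _, ht, hle, fun ⟨s₀⟩ => ?_⟩
  obtain ⟨s, hs, -⟩ := CacheSched.PTAS.program_correct I hε s₀
  refine ⟨s, hs, fun s' => ?_⟩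
  obtain ⟨s₁, hs₁, h⟩ := CacheSched.PTAS.program_correct I hε s'
  rwa [CacheSched.PTAS.isOutput_unique hs hs₁]
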